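/- Let $R$ be a field of characteristic not $2$, let $\delta\in R$ and let $n\ge 4$ be an integer. Let $\mathrm{TLD}_n(\delta)$ be the type $D$ Temperley-Lieb algebra over $R$, that is, the associative unital $R$-algebra generated by $e_{\bar 1}, e_1, e_2,\dots,e_{n-1}$ subject to the relations $e_i^2=\delta e_i$ for all $i$, $e_ie_j=e_je_i$ if $i$ and $j$ are not connected in the Dynkin diagram of type $D_n$, and $e_ie_je_i=e_i$ if $i$ and $j$ are connected in it; here the Dynkin diagram has vertices $\bar 1,1,2,\dots,n-1$ and edges $\{\bar 1,2\}$ and $\{k,k+1\}$ for $1\le k\le n-2$. Define polynomials with integer coefficients by $$P_0(x)=0,\quad P_1(x)=1,\quad P_{m+1}(x)=xP_m(x)-P_{m-1}(x)\ \ (m\ge 1),$$ $$Q_2(x)=x^2,\quad Q_3(x)=x^3-2x,\quad Q_{m+1}(x)=xQ_m(x)-Q_{m-1}(x)\ \ (m\ge 3).$$ Then $\mathrm{TLD}_n(\delta)$ is semisimple if and only if $P_s(\delta)\ne 0$ for all integers $s$ with $1<s\le n$ and $Q_t(\delta)\ne 0$ for all integers $t$ with $2<t\le n$. -/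

import Mathlib

/-- The Dynkin diagram of type `D_n`, with vertices `\bar 1, 1, 2, …, n - 1`. The vertex `\bar 1` is
the element `0` of `Fin n`, and the vertex `k` (for `1 ≤ k ≤ n - 1`) is the element `k` of `Fin n`.
The edges are `\bar 1 — 2` and `k — k + 1` for `1 ≤ k ≤ n - 2`. -/
def dynkinD (n : ℕ) : SimpleGraph (Fin n) :=
  SimpleGraph.fromRel fun i j =>
    ((i : ℕ) = 0 ∧ (j : ℕ) = 2) ∨ (1 ≤ (i : ℕ) ∧ (j : ℕ) = (i : ℕ) + 1)

/-- The defining relations of the type `D` Temperley-Lieb algebra, on the free associative unital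
algebra with one generator for each vertex of the Dynkin diagram. -/
inductive TLD.Rel {R : Type*} [CommRing R] (n : ℕ) (δ : R) :
    FreeAlgebra R (Fin n) → FreeAlgebra R (Fin n) → Prop
  | sq (i : Fin n) :
      TLD.Rel n δ (FreeAlgebra.ι R i * FreeAlgebra.ι R i) (δ • FreeAlgebra.ι R i)
  | comm (i j : Fin n) (h : ¬ (dynkinD n).Adj i j) :
      TLD.Rel n δ (FreeAlgebra.ι R i * FreeAlgebra.ι R j) (FreeAlgebra.ι R j * FreeAlgebra.ι R i)
  | adj (i j : Fin n) (h : (dynkinD n).Adj i j) :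
      TLD.Rel n δ (FreeAlgebra.ι R i * FreeAlgebra.ι R j * FreeAlgebra.ι R i) (FreeAlgebra.ι R i)

/-- The type `D` Temperley-Lieb algebra `TLD_n(δ)` over `R`, by generators and relations. -/
abbrev TLD {R : Type*} [CommRing R] (n : ℕ) (δ : R) : Type _ :=
  RingQuot (TLD.Rel n δ)

/-- The type `A` Chebyshev polynomials: `P_0 = 0`, `P_1 = 1`, `P_{n+1} = x P_n - P_{n-1}`. -/
noncomputable def chebyshevA : ℕ → Polynomial ℤ
  | 0 => 0
  | 1 => 1
  | n + 2 => Polynomial.X * chebyshevA (n + 1) - chebyshevA n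

/-- The type `D` Chebyshev polynomials: `Q_2 = x^2`, `Q_3 = x^3 - 2x`, and
`Q_{n+1} = x Q_n - Q_{n-1}` for `n ≥ 3`. The values at `0` and `1` are placeholders, never used. -/
noncomputable def chebyshevD : ℕ → Polynomial ℤ
  | 0 => 0
  | 1 => 0
  | 2 => Polynomial.X ^ 2
  | 3 => Polynomial.X ^ 3 - 2 * Polynomial.X
  | n + 4 => Polynomial.X * chebyshevD (n + 3) - chebyshevD (n + 2)

/-! Semisimplicity is handled as complete reducibility: a set of operators is `StablyComplemented`
if every stable subspace has a stable complement. No dimension count or cellular basis is needed.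

The generators `e 0` and `e 1` form a fork. If δ ≠ 0, the ideal generated by `e 0 * e 1` contains
elements `w i = forkWord δ e i` that satisfy the defining relations again, with `w 0 = w 1`. The
differences `e i - w i` satisfy them too, with fork product 0, and `w i * (e j - w j) = 0`
(`TLSys.forkWord_mul`). The Jones–Wenzl projection built from the `w i`, when it exists, commutes
with the generators and splits every module into two: one for the quotient `e 0 = e 1` (type `A`, κ
= δ) and one for the quotient `e 0 * e 1 = 0` (κ = 0).

In either quotient the projections f_m satisfy e_m f_m e_m = τ_m e_m f_{m-1}. At δ, the scalar τ_m
is P_{m+1}/P_m for κ = δ and Q_{m+1}/Q_m for κ = 0 (`eq_tau_mul`). If no τ_m with m < n vanishes,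
f_n is an idempotent annihilated by all generators. The rest of the module is controlled by the last
generator, whose corner comes from the algebra with two generators fewer (`TLSys.corner_last`), so
complete reducibility follows by induction in steps of two (`StablyComplemented.of_corner`).

Conversely, let τ_k be the first scalar to vanish. Then z = f_k e_k f_k satisfies z a z = 0 for all
a in the algebra on the generators up to e_k, and z or a variant of it can be carried to all n
generators. Complete reducibility forces such a z to be 0. An explicit representation on words in
four letters, by cup-cap operators with loop value δ, shows that it is not; a sign decoration on `e
0` selects the quotient. The value δ = 0, where the splitting is unavailable, is excluded by a
deformed reflection representation. -/

/-- Adjacency in the infinite Dynkin diagram of type `D`, with the vertices numbered as in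
`dynkinD`. -/
def AdjD (i j : ℕ) : Prop :=
  (i = 0 ∧ j = 2) ∨ (1 ≤ i ∧ j = i + 1) ∨ (j = 0 ∧ i = 2) ∨ (1 ≤ j ∧ i = j + 1)

/-- The elements `e 0, …, e (n - 1)` of an algebra satisfy the relations of `TLD n δ`. -/
structure TLSys {R A : Type*} [CommRing R] [Ring A] [Algebra R A] (δ : R) (n : ℕ) (e : ℕ → A) :
    Prop where
  sq : ∀ i, i < n → e i * e i = δ • e i
  comm : ∀ i j, i < n → j < n → ¬ AdjD i j → e i * e j = e j * e i
  adj : ∀ i j, i < n → j < n → AdjD i j → e i * e j * e i = e i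

/-- The elements `e 0, …, e (m - 1)` if `2 ≤ m`, and nothing if `m ≤ 1`. -/
def tlGen {A : Type*} (e : ℕ → A) (m : ℕ) : Set A :=
  {x | ∃ i, i < m ∧ 2 ≤ m ∧ x = e i}

/-- The subalgebra generated by `e 0, …, e (m - 1)` if `2 ≤ m`, and the scalars if `m ≤ 1`. -/
def tlAlg (R : Type*) {A : Type*} [CommRing R] [Ring A] [Algebra R A] (e : ℕ → A) (m : ℕ) :
    Subalgebra R A :=
  Algebra.adjoin R (tlGen e m)

/-! ### Normal forms and corners under the fork relation -/

section Algebra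

variable {R A : Type*} [CommRing R] [Ring A] [Algebra R A] {δ κ : R} {n : ℕ} {e : ℕ → A}

theorem TLSys.mono (h : TLSys δ n e) {m : ℕ} (hm : m ≤ n) : TLSys δ m e :=
  ⟨fun i hi => h.sq i (by omega), fun i j hi hj => h.comm i j (by omega) (by omega),
    fun i j hi hj => h.adj i j (by omega) (by omega)⟩

theorem TLSys.up_down (h : TLSys δ n e) {i : ℕ} (h1 : 1 ≤ i) (hi : i + 1 < n) :
    e i * e (i + 1) * e i = e i :=
  h.adj _ _ (by omega) (by omega) (by unfold AdjD; omega)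

theorem TLSys.down_up (h : TLSys δ n e) {i : ℕ} (h1 : 1 ≤ i) (hi : i + 1 < n) :
    e (i + 1) * e i * e (i + 1) = e (i + 1) :=
  h.adj _ _ (by omega) (by omega) (by unfold AdjD; omega)

theorem TLSys.commute_far (h : TLSys δ n e) {i j : ℕ} (hij : i + 2 ≤ j) (hj3 : 3 ≤ j)
    (hj : j < n) : Commute (e i) (e j) :=
  h.comm _ _ (by omega) (by omega) (by unfold AdjD; omega)

theorem tlAlg_mem (R : Type*) [CommRing R] [Algebra R A] {m i : ℕ} (hm : 2 ≤ m) (hi : i < m) :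
    e i ∈ tlAlg R e m :=
  Algebra.subset_adjoin ⟨i, hi, hm, rfl⟩

theorem tlAlg_mono (R : Type*) [CommRing R] [Algebra R A] {m k : ℕ} (hm : m ≤ k) :
    tlAlg R e m ≤ tlAlg R e k :=
  Algebra.adjoin_mono fun _ ⟨i, hi, h2, hx⟩ => ⟨i, by omega, by omega, hx⟩

theorem adjoin_le_of_mul_mem {S : Set A} (T : Submodule R A) (h1 : 1 ∈ T)
    (hS : ∀ s ∈ S, ∀ t ∈ T, s * t ∈ T) {a : A} (ha : a ∈ Algebra.adjoin R S) : a ∈ T := by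
  suffices h : ∀ t ∈ T, a * t ∈ T by simpa using h 1 h1
  induction ha using Algebra.adjoin_induction with
  | mem x hx => exact hS x hx
  | algebraMap r =>
    intro t ht
    rw [← Algebra.smul_def]
    exact T.smul_mem _ ht
  | add x y _ _ hx hy =>
    intro t ht
    rw [add_mul]
    exact T.add_mem (hx t ht) (hy t ht)
  | mul x y _ _ hx hy =>
    intro t ht
    rw [mul_assoc]
    exact hx _ (hy t ht)

/-- The case `m = 1`, `j = 2` explains the convention that one generator counts as none: `e 0` does
not commute with `e 2`, but scalars do. -/
theorem TLSys.commute_tlAlg (h : TLSys δ n e) {m j : ℕ} (hmj : m + 1 ≤ j) (hj : j < n) {a : A}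
    (ha : a ∈ tlAlg R e m) : Commute a (e j) := by
  induction ha using Algebra.adjoin_induction with
  | mem x hx =>
    obtain ⟨i, hi, h2, rfl⟩ := hx
    exact h.commute_far (by omega) (by omega) hj
  | algebraMap r => exact Algebra.commutes r _
  | add x y _ _ hx hy => exact hx.add_left hy
  | mul x y _ _ hx hy => exact hx.mul_left hy

/-- The relation cutting out the type `A` quotient (`κ = δ`) and the complementary quotient
(`κ = 0`). -/
def ForkRel (κ : R) (e : ℕ → A) : Prop :=
  e 0 * e 1 = κ • e 0 ∧ e 0 * e 1 = κ • e 1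

theorem TLSys.comm_fork (h : TLSys δ n e) (hn : 2 ≤ n) : e 1 * e 0 = e 0 * e 1 :=
  h.comm 1 0 (by omega) (by omega) (by unfold AdjD; omega)

theorem TLSys.tlAlg_two (h : TLSys δ n e) (hn : 2 ≤ n) (hf : ForkRel κ e) {a : A}
    (ha : a ∈ tlAlg R e 2) : ∃ x y z : R, a = x • 1 + y • e 0 + z • e 1 := by
  have key : a ∈ Submodule.span R {1, e 0, e 1} := by
    have m1 : (1 : A) ∈ Submodule.span R {1, e 0, e 1} := Submodule.subset_span (by simp)
    have m2 : e 0 ∈ Submodule.span R {1, e 0, e 1} := Submodule.subset_span (by simp)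
    have m3 : e 1 ∈ Submodule.span R {1, e 0, e 1} := Submodule.subset_span (by simp)
    refine adjoin_le_of_mul_mem _ m1 ?_ ha
    rintro s ⟨i, hi, -, rfl⟩ t ht
    induction ht using Submodule.span_induction with
    | zero => simp
    | add x y _ _ hx hy => rw [mul_add]; exact Submodule.add_mem _ hx hy
    | smul r x _ hx => rw [mul_smul_comm]; exact Submodule.smul_mem _ _ hx
    | mem x hx =>
      have hi' : i = 0 ∨ i = 1 := by omega
      rcases hx with rfl | rfl | rfl <;> rcases hi' with rfl | rfl
      · simpa using m2
      · simpa using m3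
      · rw [h.sq 0 (by omega)]; exact Submodule.smul_mem _ _ m2
      · rw [h.comm_fork hn, hf.1]; exact Submodule.smul_mem _ _ m2
      · rw [hf.1]; exact Submodule.smul_mem _ _ m2
      · rw [h.sq 1 (by omega)]; exact Submodule.smul_mem _ _ m3
  rw [Submodule.mem_span_insert] at key
  obtain ⟨x, w, hw, rfl⟩ := key
  obtain ⟨y, z, rfl⟩ := Submodule.mem_span_pair.1 hw
  exact ⟨x, y, z, by rw [add_assoc]⟩

theorem TLSys.zero_two (h : TLSys δ n e) (hn : 3 ≤ n) : e 0 * e 2 * e 0 = e 0 :=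
  h.adj _ _ (by omega) (by omega) (by unfold AdjD; omega)

theorem TLSys.two_zero (h : TLSys δ n e) (hn : 3 ≤ n) : e 2 * e 0 * e 2 = e 2 :=
  h.adj _ _ (by omega) (by omega) (by unfold AdjD; omega)

/-- The defining relations do not reduce `e 2 * e 0 * e 1 * e 2` to a multiple of `e 2`. The fork
relation removes `e 0 * e 1` from the spanning set; this is why the corner argument is run in the
two quotients separately. -/
theorem TLSys.corner_two (h : TLSys δ n e) (hn : 3 ≤ n) (hf : ForkRel κ e) {a : A}
    (ha : a ∈ tlAlg R e 2) : ∃ b ∈ tlAlg R e 1, e 2 * a * e 2 = b * e 2 := by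
  obtain ⟨x, y, z, rfl⟩ := h.tlAlg_two (by omega) hf ha
  refine ⟨algebraMap R A (x * δ + y + z), Subalgebra.algebraMap_mem _ _, ?_⟩
  rw [← Algebra.smul_def]
  simp only [mul_add, add_mul, mul_smul_comm, smul_mul_assoc, mul_one, h.sq 2 (by omega),
    h.two_zero hn, h.down_up le_rfl (by omega : 1 + 1 < n), add_smul, mul_smul]

/-- The products `a * e m * b` with `a` and `b` in the algebra on the generators below `m`. -/
def throughSpan (R : Type*) [CommRing R] [Algebra R A] (e : ℕ → A) (m : ℕ) : Submodule R A :=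
  Submodule.span R {x | ∃ a ∈ tlAlg R e m, ∃ b ∈ tlAlg R e m, x = a * e m * b}

/-- The corner hypothesis merges two occurrences of `e m` into one, so words with at most one `e m`
suffice. -/
theorem tlAlg_succ_of_corner {m : ℕ} (hm : 2 ≤ m)
    (hc : ∀ a ∈ tlAlg R e m, ∃ b ∈ tlAlg R e (m - 1), e m * a * e m = b * e m) {a : A}
    (ha : a ∈ tlAlg R e (m + 1)) :
    a ∈ Subalgebra.toSubmodule (tlAlg R e m) ⊔ throughSpan R e m := by
  refine adjoin_le_of_mul_mem _ (Submodule.mem_sup_left (one_mem (tlAlg R e m))) ?_ ha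
  rintro s ⟨i, hi, -, rfl⟩ t ht
  obtain ⟨x, hx, y, hy, rfl⟩ := Submodule.mem_sup.1 ht
  rw [mul_add]
  rcases Nat.lt_succ_iff_lt_or_eq.1 hi with hi | rfl
  · have hs : e i ∈ tlAlg R e m := tlAlg_mem R hm hi
    refine Submodule.add_mem _ (Submodule.mem_sup_left (show e i * x ∈ tlAlg R e m from mul_mem hs hx))
      (Submodule.mem_sup_right ?_)
    clear ht
    induction hy using Submodule.span_induction with
    | zero => simp
    | add x y _ _ hx hy => rw [mul_add]; exact Submodule.add_mem _ hx hy
    | smul r x _ hx => rw [mul_smul_comm]; exact Submodule.smul_mem _ _ hx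
    | mem x hx =>
      obtain ⟨a, ha, b, hb, rfl⟩ := hx
      exact Submodule.subset_span ⟨e i * a, mul_mem hs ha, b, hb, by simp only [mul_assoc]⟩
  · refine Submodule.add_mem _ (Submodule.mem_sup_right ?_) (Submodule.mem_sup_right ?_)
    · exact Submodule.subset_span ⟨1, one_mem _, x, hx, by rw [one_mul]⟩
    clear ht
    induction hy using Submodule.span_induction with
    | zero => simp
    | add x y _ _ hx hy => rw [mul_add]; exact Submodule.add_mem _ hx hy
    | smul r x _ hx => rw [mul_smul_comm]; exact Submodule.smul_mem _ _ hx
    | mem x hx =>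
      obtain ⟨a, ha, b, hb, rfl⟩ := hx
      obtain ⟨c, hc', hce⟩ := hc a ha
      exact Submodule.subset_span ⟨c, tlAlg_mono R (by omega) hc', b, hb, by
        rw [← hce]; simp only [mul_assoc]⟩

/-- The corner at `m` gives the normal form one level up: each element is a sum of some `x` without
`e m` and of terms `a * e m * b`. Since `a`, `b`, `x` commute with `e (m + 1)`, sandwiching turns
these into `δ • x` and `a * b`. -/
theorem TLSys.corner (h : TLSys δ n e) (hf : ForkRel κ e) {m : ℕ} (hm : 2 ≤ m) (hmn : m < n) :
    ∀ a ∈ tlAlg R e m, ∃ b ∈ tlAlg R e (m - 1), e m * a * e m = b * e m := by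
  induction m, hm using Nat.le_induction with
  | base => exact fun a ha => h.corner_two (by omega) hf ha
  | succ m hm ih =>
    intro a ha
    obtain ⟨x, hx, y, hy, rfl⟩ :=
      Submodule.mem_sup.1 (tlAlg_succ_of_corner hm (ih (by omega)) ha)
    have hcx : Commute x (e (m + 1)) := h.commute_tlAlg le_rfl hmn hx
    have hy' : ∃ b ∈ tlAlg R e m, e (m + 1) * y * e (m + 1) = b * e (m + 1) := by
      clear ha
      induction hy using Submodule.span_induction with
      | zero => exact ⟨0, zero_mem _, by simp⟩
      | add x y _ _ hx hy =>
        obtain ⟨b, hb, hb'⟩ := hx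
        obtain ⟨c, hc, hc'⟩ := hy
        exact ⟨b + c, add_mem hb hc, by rw [mul_add, add_mul, hb', hc', add_mul]⟩
      | smul r x _ hx =>
        obtain ⟨b, hb, hb'⟩ := hx
        exact ⟨r • b, Subalgebra.smul_mem _ hb _, by
          rw [mul_smul_comm, smul_mul_assoc, hb', smul_mul_assoc]⟩
      | mem x hx =>
        obtain ⟨a, ha, b, hb, rfl⟩ := hx
        have hca : Commute a (e (m + 1)) := h.commute_tlAlg le_rfl hmn ha
        have hcb : Commute b (e (m + 1)) := h.commute_tlAlg le_rfl hmn hb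
        refine ⟨a * b, mul_mem ha hb, ?_⟩
        calc e (m + 1) * (a * e m * b) * e (m + 1)
            = (e (m + 1) * a) * e m * (b * e (m + 1)) := by simp only [mul_assoc]
          _ = a * (e (m + 1) * e m * e (m + 1)) * b := by
            rw [← hca.eq, hcb.eq]; simp only [mul_assoc]
          _ = a * b * e (m + 1) := by
            rw [h.down_up (by omega) hmn, mul_assoc, ← hcb.eq, mul_assoc]
    obtain ⟨b, hb, hb'⟩ := hy'
    refine ⟨δ • x + b, add_mem (Subalgebra.smul_mem _ hx _) hb, ?_⟩
    rw [mul_add, add_mul, hb', ← hcx.eq, mul_assoc, h.sq _ hmn, add_mul, mul_smul_comm,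
      smul_mul_assoc]

/-- The corner cut out by the last generator comes from the algebra with two generators fewer. -/
theorem TLSys.corner_last (h : TLSys δ n e) (hf : ForkRel κ e) {m : ℕ} (hm : 1 ≤ m)
    (hmn : m + 2 ≤ n) {a : A} (ha : a ∈ tlAlg R e (m + 2)) :
    ∃ b ∈ tlAlg R e m, e (m + 1) * a * e (m + 1) = b * e (m + 1) := by
  have hc := h.corner hf (show 2 ≤ m + 1 by omega) (by omega)
  rw [Nat.add_sub_cancel] at hc
  have hcm : ∀ {x}, x ∈ tlAlg R e m → Commute x (e (m + 1)) :=
    fun hx => h.commute_tlAlg le_rfl (by omega) hx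
  obtain ⟨x, hx, y, hy, rfl⟩ :=
    Submodule.mem_sup.1 (tlAlg_succ_of_corner (show 2 ≤ m + 1 by omega) (by simpa using hc) ha)
  have hy' : ∃ b ∈ tlAlg R e m, e (m + 1) * y * e (m + 1) = b * e (m + 1) := by
    clear ha
    induction hy using Submodule.span_induction with
    | zero => exact ⟨0, zero_mem _, by simp⟩
    | add x y _ _ hx hy =>
      obtain ⟨b, hb, hb'⟩ := hx
      obtain ⟨c, hc, hc'⟩ := hy
      exact ⟨b + c, add_mem hb hc, by rw [mul_add, add_mul, hb', hc', add_mul]⟩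
    | smul r x _ hx =>
      obtain ⟨b, hb, hb'⟩ := hx
      exact ⟨r • b, Subalgebra.smul_mem _ hb _, by
        rw [mul_smul_comm, smul_mul_assoc, hb', smul_mul_assoc]⟩
    | mem x hx =>
      obtain ⟨a, ha, b, hb, rfl⟩ := hx
      obtain ⟨a', ha', hae⟩ := hc a ha
      obtain ⟨b', hb', hbe⟩ := hc b hb
      refine ⟨a' * b', mul_mem ha' hb', ?_⟩
      calc e (m + 1) * (a * e (m + 1) * b) * e (m + 1)
          = (e (m + 1) * a * e (m + 1)) * (b * e (m + 1)) := by simp only [mul_assoc]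
        _ = a' * (e (m + 1) * b * e (m + 1)) := by rw [hae]; simp only [mul_assoc]
        _ = a' * b' * e (m + 1) := by rw [hbe, mul_assoc]
  obtain ⟨b, hb, hb'⟩ := hy'
  obtain ⟨c, hc1, hc2⟩ := hc x hx
  exact ⟨c + b, add_mem hc1 hb, by rw [mul_add, add_mul, hb', hc2, add_mul]⟩

end Algebra

/-! ### Jones–Wenzl projections -/

/-- The scalars in the recursion for the Jones–Wenzl projections. -/
def tau {R : Type*} [Field R] (δ μ : R) : ℕ → R
  | 0 => 1
  | 1 => 1
  -- For μ = 1/(δ + κ) this is P_3/P_2 at δ when κ = δ, and Q_3/Q_2 when κ = 0. The values at 0 and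
  -- 1 are placeholders.
  | 2 => δ - 2 * μ
  | m + 3 => δ - (tau δ μ (m + 2))⁻¹

/-- The Jones–Wenzl projections. -/
def jonesWenzl {R A : Type*} [Field R] [Ring A] [Algebra R A] (δ μ : R) (e : ℕ → A) : ℕ → A
  | 0 => 1
  | 1 => 1
  | 2 => 1 - μ • (e 0 + e 1)
  | m + 3 => jonesWenzl δ μ e (m + 2) - (tau δ μ (m + 2))⁻¹ •
      (jonesWenzl δ μ e (m + 2) * e (m + 2) * jonesWenzl δ μ e (m + 2))

theorem tau_succ {R : Type*} [Field R] (δ μ : R) {m : ℕ} (hm : 2 ≤ m) :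
    tau δ μ (m + 1) = δ - (tau δ μ m)⁻¹ := by
  obtain ⟨k, rfl⟩ := Nat.exists_eq_add_of_le' hm
  rfl

section JonesWenzl

variable {R A : Type*} [Field R] [Ring A] [Algebra R A] {δ κ μ : R} {n : ℕ} {e : ℕ → A}

theorem jonesWenzl_succ (δ μ : R) (e : ℕ → A) {m : ℕ} (hm : 2 ≤ m) :
    jonesWenzl δ μ e (m + 1) = jonesWenzl δ μ e m - (tau δ μ m)⁻¹ •
      (jonesWenzl δ μ e m * e m * jonesWenzl δ μ e m) := by
  obtain ⟨k, rfl⟩ := Nat.exists_eq_add_of_le' hm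
  rfl

theorem jonesWenzl_mem (δ μ : R) (e : ℕ → A) (m : ℕ) : jonesWenzl δ μ e m ∈ tlAlg R e m := by
  induction m using Nat.strong_induction_on with
  | _ m ih =>
    match m, ih with
    | 0, _ => exact one_mem _
    | 1, _ => exact one_mem _
    | 2, _ =>
      exact sub_mem (one_mem _) (Subalgebra.smul_mem _ (add_mem (tlAlg_mem R le_rfl (by omega))
        (tlAlg_mem R le_rfl (by omega))) _)
    | m + 3, ih =>
      have h1 : jonesWenzl δ μ e (m + 2) ∈ tlAlg R e (m + 3) :=
        tlAlg_mono R (by omega) (ih (m + 2) (by omega))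
      exact sub_mem h1 (Subalgebra.smul_mem _ (mul_mem (mul_mem h1
        (tlAlg_mem R (by omega) (by omega))) h1) _)

/-- The defining properties of the Jones–Wenzl projection `f` on `m` strands, given the one `g` on
`m - 1` strands. -/
structure IsJonesWenzl (e : ℕ → A) (m : ℕ) (f g : A) : Prop where
  left : ∀ i < m, e i * f = 0
  right : ∀ i < m, f * e i = 0
  idem : f * f = f
  absorb_left : g * f = f
  absorb_right : f * g = f

/-- By the fork relation, `e 0` and `e 1` multiply `1 - μ • (e 0 + e 1)` by the scalar 1 - μ(δ + κ),
which the choice of μ makes 0. -/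
theorem isJonesWenzl_two (h : TLSys δ n e) (hf : ForkRel κ e) (hμ : μ * (δ + κ) = 1)
    (hn : 2 ≤ n) : IsJonesWenzl e 2 (jonesWenzl δ μ e 2) 1 := by
  have hμ0 : μ * δ + μ * κ = 1 := by rw [← mul_add, hμ]
  have hl : ∀ i < 2, e i * jonesWenzl δ μ e 2 = 0 := by
    intro i hi
    have hi : i = 0 ∨ i = 1 := by omega
    rcases hi with rfl | rfl
    · simp only [jonesWenzl, mul_sub, mul_one, mul_smul_comm, mul_add, h.sq 0 (by omega), hf.1]
      rw [← add_smul, ← mul_smul, mul_add, hμ0, one_smul, sub_self]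
    · simp only [jonesWenzl, mul_sub, mul_one, mul_smul_comm, mul_add, h.sq 1 (by omega),
        h.comm_fork hn, hf.2]
      rw [← add_smul, ← mul_smul, mul_add, add_comm, hμ0, one_smul, sub_self]
  refine ⟨hl, ?_, ?_, one_mul _, mul_one _⟩
  · intro i hi
    have hi : i = 0 ∨ i = 1 := by omega
    rcases hi with rfl | rfl
    · simp only [jonesWenzl, sub_mul, one_mul, smul_mul_assoc, add_mul, h.sq 0 (by omega),
        h.comm_fork hn, hf.1]
      rw [← add_smul, ← mul_smul, mul_add, hμ0, one_smul, sub_self]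
    · simp only [jonesWenzl, sub_mul, one_mul, smul_mul_assoc, add_mul, h.sq 1 (by omega), hf.2]
      rw [← add_smul, ← mul_smul, mul_add, add_comm, hμ0, one_smul, sub_self]
  · conv_lhs => enter [1]; rw [jonesWenzl]
    rw [sub_mul, one_mul, smul_mul_assoc, add_mul, hl 0 (by omega), hl 1 (by omega)]
    simp

theorem TLSys.through_two (h : TLSys δ n e) (hn : 2 < n) :
    e 2 * jonesWenzl δ μ e 2 * e 2 = tau δ μ 2 • (e 2 * jonesWenzl δ μ e 1) := by
  simp only [jonesWenzl, tau, mul_sub, sub_mul, mul_one, mul_smul_comm, smul_mul_assoc, mul_add,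
    add_mul, h.sq 2 hn, h.two_zero hn, h.down_up le_rfl (show 1 + 1 < n by omega), sub_smul,
    mul_smul, two_smul, smul_add]

/-- The coefficient τ⁻¹ is the one that kills the new generator: e_m f e_m f = τ e_m g f = τ e_m f.
On the other side, `g` is first moved past `e m`. -/
theorem IsJonesWenzl.succ (h : TLSys δ n e) {m : ℕ} (hm : 2 ≤ m) (hmn : m < n) {τ : R}
    (hτ : τ ≠ 0) {f g : A} (hg : g ∈ tlAlg R e (m - 1)) (hj : IsJonesWenzl e m f g)
    (ht : e m * f * e m = τ • (e m * g)) :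
    IsJonesWenzl e (m + 1) (f - τ⁻¹ • (f * e m * f)) f := by
  have hgc : Commute g (e m) := h.commute_tlAlg (by omega) (by omega) hg
  have hl : ∀ i < m + 1, e i * (f - τ⁻¹ • (f * e m * f)) = 0 := by
    intro i hi
    rcases Nat.lt_succ_iff_lt_or_eq.1 hi with hi | rfl
    · rw [mul_sub, mul_smul_comm, ← mul_assoc, ← mul_assoc, hj.left i hi]
      simp
    · rw [mul_sub, mul_smul_comm, ← mul_assoc, ← mul_assoc, ht, smul_mul_assoc, mul_assoc,
        hj.absorb_left, smul_smul, inv_mul_cancel₀ hτ, one_smul, sub_self]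
  have hr : ∀ i < m + 1, (f - τ⁻¹ • (f * e m * f)) * e i = 0 := by
    intro i hi
    rcases Nat.lt_succ_iff_lt_or_eq.1 hi with hi | rfl
    · rw [sub_mul, smul_mul_assoc, mul_assoc, mul_assoc, hj.right i hi]
      simp
    · rw [sub_mul, smul_mul_assoc, mul_assoc, mul_assoc, ← mul_assoc (e i) f, ht,
        mul_smul_comm, ← hgc.eq, ← mul_assoc, hj.absorb_right, smul_smul, inv_mul_cancel₀ hτ,
        one_smul, sub_self]
  have ha : f * (f - τ⁻¹ • (f * e m * f)) = f - τ⁻¹ • (f * e m * f) := by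
    rw [mul_sub, hj.idem, mul_smul_comm, ← mul_assoc, ← mul_assoc, hj.idem]
  refine ⟨hl, hr, ?_, ha, ?_⟩
  · have key : ∀ F, f * F = F → e m * F = 0 → (f - τ⁻¹ • (f * e m * f)) * F = F := by
      intro F h1 h2
      rw [sub_mul, h1, smul_mul_assoc, mul_assoc, h1, mul_assoc, h2, mul_zero, smul_zero, sub_zero]
    exact key _ ha (hl m (by omega))
  · rw [sub_mul, hj.idem, smul_mul_assoc, mul_assoc (f * e m), hj.idem]

/-- As `f` commutes with `e (m + 1)`, the correction term collapses through e_{m+1} e_m e_{m+1} =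
e_{m+1}. This produces the recursion τ ↦ δ - τ⁻¹. -/
theorem IsJonesWenzl.through_succ (h : TLSys δ n e) {m : ℕ} (hm : 2 ≤ m) (hmn : m + 1 < n) {τ : R}
    {f g : A} (hf : f ∈ tlAlg R e m) (hj : IsJonesWenzl e m f g) :
    e (m + 1) * (f - τ⁻¹ • (f * e m * f)) * e (m + 1) = (δ - τ⁻¹) • (e (m + 1) * f) := by
  have hfc : Commute f (e (m + 1)) := h.commute_tlAlg le_rfl hmn hf
  rw [mul_sub, sub_mul, ← hfc.eq, mul_assoc f, h.sq _ hmn, mul_smul_comm, mul_smul_comm,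
    smul_mul_assoc, sub_smul]
  congr 2
  calc e (m + 1) * (f * e m * f) * e (m + 1)
      = (e (m + 1) * f) * e m * (f * e (m + 1)) := by simp only [mul_assoc]
    _ = (f * e (m + 1)) * e m * (e (m + 1) * f) := by rw [hfc.eq]
    _ = f * (e (m + 1) * e m * e (m + 1)) * f := by simp only [mul_assoc]
    _ = f * e (m + 1) := by
      rw [h.down_up (by omega) hmn, mul_assoc, ← hfc.eq, ← mul_assoc, hj.idem]

theorem isJonesWenzl_and_through (h : TLSys δ n e) (hf : ForkRel κ e) (hμ : μ * (δ + κ) = 1)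
    {m : ℕ} (hm : 2 ≤ m) (hmn : m ≤ n) (hτ : ∀ k, 2 ≤ k → k < m → tau δ μ k ≠ 0) :
    IsJonesWenzl e m (jonesWenzl δ μ e m) (jonesWenzl δ μ e (m - 1)) ∧
      (m < n → e m * jonesWenzl δ μ e m * e m =
        tau δ μ m • (e m * jonesWenzl δ μ e (m - 1))) := by
  induction m, hm using Nat.le_induction with
  | base => exact ⟨isJonesWenzl_two h hf hμ hmn, fun h3 => h.through_two h3⟩
  | succ m hm ih =>
    rw [tau_succ _ _ hm, jonesWenzl_succ _ _ _ hm]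
    obtain ⟨h1, h2⟩ := ih (by omega) fun k hk hkm => hτ k hk (by omega)
    exact ⟨h1.succ h hm (by omega) (hτ m hm (by omega)) (jonesWenzl_mem _ _ _ _) (h2 (by omega)),
      fun hlt => h1.through_succ h hm hlt (jonesWenzl_mem _ _ _ _)⟩

end JonesWenzl

/-! ### Jones–Wenzl elements acting on modules -/

section Module

variable {R M : Type*} [Field R] [AddCommGroup M] [Module R M] {δ κ μ : R} {n : ℕ}
  {e : ℕ → Module.End R M}

/-- The element is 1 plus a combination of nonempty words in the generators, whatever the scalars
are. Neither this fact nor its dual below requires that the projections exist. -/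
theorem jonesWenzl_apply_of_killed (δ μ : R) {m : ℕ} {y : M} (hy : ∀ i < m, e i y = 0) :
    jonesWenzl δ μ e m y = y := by
  induction m using Nat.strong_induction_on with
  | _ m ih =>
    match m, ih with
    | 0, _ => rfl
    | 1, _ => rfl
    | 2, _ => simp [jonesWenzl, hy 0, hy 1]
    | m + 3, ih =>
      have := ih (m + 2) (by omega) fun i hi => hy i (by omega)
      simp [jonesWenzl, this, hy (m + 2)]

theorem jonesWenzl_apply_sub_mem (δ μ : R) {m : ℕ} {S : Submodule R M}
    (hS : ∀ i < m, ∀ x, e i x ∈ S) (x : M) : jonesWenzl δ μ e m x - x ∈ S := by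
  induction m using Nat.strong_induction_on generalizing x with
  | _ m ih =>
    match m, ih with
    | 0, _ => simp [jonesWenzl]
    | 1, _ => simp [jonesWenzl]
    | 2, _ =>
      have := S.neg_mem (S.smul_mem μ (S.add_mem (hS 0 (by omega) x) (hS 1 (by omega) x)))
      rw [jonesWenzl]
      convert this using 1
      simp
    | m + 3, ih =>
      have ih' := ih (m + 2) (by omega) fun i hi => hS i (by omega)
      have h1 : jonesWenzl δ μ e (m + 2) (e (m + 2) (jonesWenzl δ μ e (m + 2) x)) ∈ S := by
        have := S.add_mem (ih' (e (m + 2) (jonesWenzl δ μ e (m + 2) x)))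
          (hS (m + 2) (by omega) (jonesWenzl δ μ e (m + 2) x))
        simpa using this
      have h2 := S.sub_mem (ih' x) (S.smul_mem (tau δ μ (m + 2))⁻¹ h1)
      rw [jonesWenzl]
      convert h2 using 1
      simp only [LinearMap.sub_apply, LinearMap.smul_apply, Module.End.mul_apply]
      abel

end Module

/-! ### Stable complements and their transfer -/

section Complement

variable {R M : Type*} [Field R] [AddCommGroup M] [Module R M]

/-- A subspace is stable under a set of operators. -/
def Stable (T : Set (Module.End R M)) (N : Submodule R M) : Prop :=
  ∀ t ∈ T, ∀ x ∈ N, t x ∈ N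

/-- Every subspace stable under the operators has a stable complement. -/
def StablyComplemented (T : Set (Module.End R M)) : Prop :=
  ∀ N : Submodule R M, Stable T N → ∃ C, Stable T C ∧ IsCompl N C

theorem Stable.adjoin {T : Set (Module.End R M)} {N : Submodule R M} (h : Stable T N)
    {a : Module.End R M} (ha : a ∈ Algebra.adjoin R T) {x : M} (hx : x ∈ N) : a x ∈ N := by
  induction ha using Algebra.adjoin_induction generalizing x with
  | mem t ht => exact h t ht x hx
  | algebraMap r => exact N.smul_mem r hx
  | add a b _ _ iha ihb => exact N.add_mem (iha hx) (ihb hx)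
  | mul a b _ _ iha ihb => exact iha (ihb hx)

theorem stablyComplemented_empty : StablyComplemented (∅ : Set (Module.End R M)) := fun N _ => by
  obtain ⟨C, hC⟩ := exists_isCompl N
  exact ⟨C, fun _ h => h.elim, hC⟩

/-- Complements on the two summands cut out by an idempotent glue to a complement. -/
theorem isCompl_sup_of_idempotent {g : Module.End R M} {N C₁ C₂ : Submodule R M}
    (hN : ∀ x ∈ N, g x ∈ N) (h₁ : ∀ x ∈ C₁, g x = x) (h₂ : ∀ x ∈ C₂, g x = 0)
    (d₁ : Disjoint N C₁) (d₂ : Disjoint N C₂) (s₁ : ∀ x, g x ∈ N ⊔ C₁)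
    (s₂ : ∀ x, x - g x ∈ N ⊔ C₂) : IsCompl N (C₁ ⊔ C₂) := by
  constructor
  · rw [Submodule.disjoint_def]
    intro x hxN hx
    obtain ⟨y, hy, z, hz, rfl⟩ := Submodule.mem_sup.1 hx
    have hgx : g (y + z) = y := by rw [map_add, h₁ y hy, h₂ z hz, add_zero]
    have hy0 : y = 0 := Submodule.disjoint_def.1 d₁ y (hgx ▸ hN _ hxN) hy
    subst hy0
    rw [zero_add] at hxN ⊢
    exact Submodule.disjoint_def.1 d₂ z hxN hz
  · rw [codisjoint_iff, eq_top_iff]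
    intro x _
    rw [← add_sub_cancel (g x) x]
    exact Submodule.add_mem _ (sup_le_sup_left le_sup_left N (s₁ x))
      (sup_le_sup_left le_sup_right N (s₂ x))

/-- A stable complement of the image of `N` under an idempotent `g` yields a complement of that
image inside the range of `g`. -/
theorem exists_complement_in_range {g : Module.End R M} (hg : g * g = g) {N C : Submodule R M}
    (hC : IsCompl (N.map g) C) :
    Disjoint N (C ⊓ LinearMap.range g) ∧ ∀ x, g x ∈ N.map g ⊔ C ⊓ LinearMap.range g := by
  have hgg : ∀ x, g (g x) = g x := fun x => by rw [← Module.End.mul_apply, hg]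
  constructor
  · rw [Submodule.disjoint_def]
    rintro _ hxN ⟨hxC, y, rfl⟩
    exact Submodule.disjoint_def.1 hC.disjoint _ ⟨_, hxN, hgg y⟩ hxC
  · intro x
    have hle : N.map g ≤ LinearMap.range g := LinearMap.map_le_range
    rw [← sup_inf_assoc_of_le _ hle, hC.sup_eq_top, top_inf_eq]
    exact ⟨x, rfl⟩

/-- A commuting idempotent splits the space into two `T`-stable summands, and a subspace stable
under it splits accordingly; each part is complemented inside its summand. -/
theorem StablyComplemented.insert_idempotent {T : Set (Module.End R M)}
    (hT : StablyComplemented T) {g : Module.End R M} (hg : g * g = g)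
    (hc : ∀ t ∈ T, g * t = t * g) : StablyComplemented (insert g T) := by
  intro N hN
  have hgN : ∀ x ∈ N, g x ∈ N := hN g (Set.mem_insert _ _)
  have hg' : (1 - g) * (1 - g) = 1 - g := by
    rw [mul_sub, sub_mul, sub_mul, hg]; simp
  have hgN' : ∀ x ∈ N, (1 - g) x ∈ N := fun x hx => N.sub_mem hx (hgN x hx)
  have hst : ∀ g' : Module.End R M, (∀ t ∈ T, g' * t = t * g') → Stable T (N.map g') := by
    rintro g' hg' t ht _ ⟨x, hx, rfl⟩
    exact ⟨t x, hN t (Set.mem_insert_of_mem _ ht) x hx, LinearMap.congr_fun (hg' t ht) x⟩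
  have hc' : ∀ t ∈ T, (1 - g) * t = t * (1 - g) := fun t ht => by
    rw [sub_mul, mul_sub, hc t ht, one_mul, mul_one]
  obtain ⟨C₁, hC₁, hi₁⟩ := hT _ (hst g hc)
  obtain ⟨C₂, hC₂, hi₂⟩ := hT _ (hst (1 - g) hc')
  obtain ⟨d₁, s₁⟩ := exists_complement_in_range hg hi₁
  obtain ⟨d₂, s₂⟩ := exists_complement_in_range hg' hi₂
  have hm₁ : N.map g ≤ N := by rintro _ ⟨x, hx, rfl⟩; exact hgN x hx
  have hm₂ : N.map (1 - g) ≤ N := by rintro _ ⟨x, hx, rfl⟩; exact hgN' x hx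
  have k₁ : ∀ x ∈ C₁ ⊓ LinearMap.range g, g x = x := by
    rintro _ ⟨-, y, rfl⟩
    rw [← Module.End.mul_apply, hg]
  have k₂ : ∀ x ∈ C₂ ⊓ LinearMap.range (1 - g), g x = 0 := by
    rintro _ ⟨-, y, rfl⟩
    rw [← Module.End.mul_apply, mul_sub, hg, mul_one, sub_self, LinearMap.zero_apply]
  refine ⟨C₁ ⊓ LinearMap.range g ⊔ C₂ ⊓ LinearMap.range (1 - g), ?_,
    isCompl_sup_of_idempotent hgN k₁ k₂ d₁ d₂ (fun x => sup_le_sup_right hm₁ _ (s₁ x))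
      (fun x => sup_le_sup_right hm₂ _ (s₂ x))⟩
  intro t ht x hx
  obtain ⟨y, hy, z, hz, rfl⟩ := Submodule.mem_sup.1 hx
  rw [map_add]
  rcases ht with rfl | ht
  · rw [k₁ y hy, k₂ z hz, add_zero]
    exact Submodule.mem_sup_left hy
  · refine Submodule.add_mem_sup ⟨hC₁ t ht y hy.1, ?_⟩ ⟨hC₂ t ht z hz.1, ?_⟩
    · obtain ⟨w, rfl⟩ := hy.2
      exact ⟨t w, LinearMap.congr_fun (hc t ht) w⟩
    · obtain ⟨w, rfl⟩ := hz.2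
      exact ⟨t w, LinearMap.congr_fun (hc' t ht) w⟩

/-- Complete reducibility passes from a corner to the whole algebra, when the complementary part is
cut out by an idempotent `f` on which the algebra acts by scalars. -/
theorem StablyComplemented.of_corner {T B : Set (Module.End R M)} (hB : StablyComplemented B)
    {e f : Module.End R M} (he : e ∈ Algebra.adjoin R T) (hf : f ∈ Algebra.adjoin R T) (hff : f * f = f)
    (hBT : B ⊆ Algebra.adjoin R T) (hBe : ∀ b ∈ B, b * e = e * b)
    (hcorner : ∀ a ∈ Algebra.adjoin R T, ∃ b ∈ Algebra.adjoin R B, e * a * e = b * e)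
    (hTf : ∀ t ∈ T, t * f = 0) (hfT : ∀ t ∈ T, f * t = 0) (heT : e ∈ T)
    (hgen : ∀ y, (∀ a ∈ Algebra.adjoin R T, e (a y) = 0) → f y = y)
    (hspan : ∀ S : Submodule R M, (∀ a ∈ Algebra.adjoin R T, ∀ x, a (e x) ∈ S) →
      ∀ x, x - f x ∈ S) : StablyComplemented T := by
  intro N hN
  have hNa : ∀ a ∈ Algebra.adjoin R T, ∀ x ∈ N, a x ∈ N := fun a ha x hx => hN.adjoin ha hx
  have heN : Stable B (N.map e) := by
    rintro b hb _ ⟨x, hx, rfl⟩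
    exact ⟨b x, hNa b (hBT hb) x hx, (LinearMap.congr_fun (hBe b hb) x).symm⟩
  obtain ⟨C, hC, hi⟩ := hB _ heN
  -- the part of the complement generated from the corner
  set D : Submodule R M :=
    Submodule.span R {z | ∃ a ∈ Algebra.adjoin R T, ∃ c ∈ C, ∃ w, c = e w ∧ z = a c} with hD
  have hDst : ∀ a ∈ Algebra.adjoin R T, ∀ x ∈ D, a x ∈ D := by
    intro a ha x hx
    induction hx using Submodule.span_induction with
    | zero => simp
    | add x y _ _ hx hy => rw [map_add]; exact D.add_mem hx hy
    | smul r x _ hx => rw [map_smul]; exact D.smul_mem _ hx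
    | mem x hx =>
      obtain ⟨b, hb, c, hc, w, hw, rfl⟩ := hx
      exact Submodule.subset_span ⟨a * b, mul_mem ha hb, c, hc, w, hw, rfl⟩
  -- The requirement `c = e w` in `D` matters here: `e (a (e w)) = b (e w)` with `b` generated by
  -- `B`, and `C` is `B`-stable.
  have heD : ∀ x ∈ D, e x ∈ C := by
    intro x hx
    induction hx using Submodule.span_induction with
    | zero => simp
    | add x y _ _ hx hy => rw [map_add]; exact C.add_mem hx hy
    | smul r x _ hx => rw [map_smul]; exact C.smul_mem _ hx
    | mem x hx =>
      obtain ⟨a, ha, c, hc, w, rfl, rfl⟩ := hx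
      obtain ⟨b, hb, hb'⟩ := hcorner a ha
      have := LinearMap.congr_fun hb' w
      simp only [Module.End.mul_apply] at this
      rw [this]
      exact hC.adjoin hb hc
  have hfD : ∀ x ∈ D, f x = 0 := by
    have hfa : ∀ a ∈ Algebra.adjoin R T, ∃ r : R, f * a = r • f := by
      intro a ha
      induction ha using Algebra.adjoin_induction with
      | mem t ht => exact ⟨0, by rw [hfT t ht, zero_smul]⟩
      | algebraMap r => exact ⟨r, by rw [← Algebra.commutes, Algebra.smul_def]⟩
      | add a b _ _ iha ihb =>
        obtain ⟨r, hr⟩ := iha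
        obtain ⟨s, hs⟩ := ihb
        exact ⟨r + s, by rw [mul_add, hr, hs, add_smul]⟩
      | mul a b _ _ iha ihb =>
        obtain ⟨r, hr⟩ := iha
        obtain ⟨s, hs⟩ := ihb
        exact ⟨r * s, by rw [← mul_assoc, hr, smul_mul_assoc, hs, mul_smul]⟩
    intro x hx
    induction hx using Submodule.span_induction with
    | zero => simp
    | add x y _ _ hx hy => rw [map_add, hx, hy, add_zero]
    | smul r x _ hx => rw [map_smul, hx, smul_zero]
    | mem x hx =>
      obtain ⟨a, ha, c, hc, w, rfl, rfl⟩ := hx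
      obtain ⟨r, hr⟩ := hfa a ha
      have h1 : f * a * e = 0 := by rw [hr, smul_mul_assoc, hfT e heT, smul_zero]
      exact LinearMap.congr_fun h1 w
  -- Any linear complement will do, since `T` kills the range of `f`.
  obtain ⟨L, hL⟩ := exists_isCompl (N.map f)
  obtain ⟨d₁, s₁⟩ := exists_complement_in_range hff hL
  have hm₁ : N.map f ≤ N := by rintro _ ⟨x, hx, rfl⟩; exact hNa f hf x hx
  have k₁ : ∀ x ∈ L ⊓ LinearMap.range f, f x = x := by
    rintro _ ⟨-, y, rfl⟩
    rw [← Module.End.mul_apply, hff]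
  refine ⟨L ⊓ LinearMap.range f ⊔ D, ?_, isCompl_sup_of_idempotent (hNa f hf) k₁ hfD d₁ ?_
    (fun x => sup_le_sup_right hm₁ _ (s₁ x)) ?_⟩
  · intro t ht x hx
    obtain ⟨y, hy, z, hz, rfl⟩ := Submodule.mem_sup.1 hx
    rw [map_add]
    refine Submodule.add_mem_sup ?_ (hDst t (Algebra.subset_adjoin ht) z hz)
    rw [← k₁ y hy, ← Module.End.mul_apply, hTf t ht]
    exact zero_mem _
  -- For `y` in `N` and `D`, each `e (a y)` lies in both `N.map e` and `C`, hence is 0. So `f y =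
  -- y`, whereas `f` kills `D`.
  · rw [Submodule.disjoint_def]
    intro y hyN hyD
    rw [← hgen y, hfD y hyD]
    intro a ha
    exact Submodule.disjoint_def.1 hi.disjoint _ ⟨a y, hNa a ha y hyN, rfl⟩
      (heD _ (hDst a ha y hyD))
  · refine hspan _ fun a ha x => ?_
    have hx : e x ∈ N.map e ⊔ C := hi.sup_eq_top ▸ Submodule.mem_top
    obtain ⟨_, ⟨y, hy, rfl⟩, c, hc, hs⟩ := Submodule.mem_sup.1 hx
    have hce : c = e (x - y) := by rw [map_sub, ← hs, add_sub_cancel_left]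
    rw [← hs, map_add]
    exact Submodule.add_mem_sup (hNa a ha _ (hNa e he y hy))
      (Submodule.subset_span ⟨a, ha, c, hc, x - y, hce, rfl⟩)

end Complement

/-! ### Complete reducibility under the fork relation -/

section Sufficiency

variable {R M : Type*} [Field R] [AddCommGroup M] [Module R M] {δ κ μ : R} {n : ℕ}
  {e : ℕ → Module.End R M}

theorem Stable.of_smul {T T' : Set (Module.End R M)} {N : Submodule R M} (h : Stable T N)
    (hT : ∀ t ∈ T', ∃ r : R, ∃ s ∈ T, t = r • s) : Stable T' N := by
  intro t ht x hx
  obtain ⟨r, s, hs, rfl⟩ := hT t ht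
  exact N.smul_mem r (h s hs x hx)

theorem StablyComplemented.of_smul {T T' : Set (Module.End R M)} (h : StablyComplemented T)
    (h₁ : ∀ t ∈ T', ∃ r : R, ∃ s ∈ T, t = r • s) (h₂ : ∀ t ∈ T, ∃ r : R, ∃ s ∈ T', t = r • s) :
    StablyComplemented T' := by
  intro N hN
  obtain ⟨C, hC, hi⟩ := h N (hN.of_smul h₂)
  exact ⟨C, hC.of_smul h₁, hi⟩

/-- The rescaled generators `δ⁻¹ • e i` are commuting idempotents. -/
theorem TLSys.stablyComplemented_two (h : TLSys δ 2 e) (hδ : δ ≠ 0) :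
    StablyComplemented (tlGen e 2) := by
  have hi : ∀ i < 2, (δ⁻¹ • e i) * (δ⁻¹ • e i) = δ⁻¹ • e i := fun i hi => by
    rw [smul_mul_smul_comm, h.sq i hi, smul_smul, mul_assoc, inv_mul_cancel₀ hδ, mul_one]
  have h0 := (stablyComplemented_empty (R := R) (M := M)).insert_idempotent (hi 0 (by omega))
    fun t ht => ht.elim
  have h1 := h0.insert_idempotent (hi 1 (by omega)) fun t ht => by
    obtain rfl : t = δ⁻¹ • e 0 := by simpa using ht
    rw [smul_mul_smul_comm, smul_mul_smul_comm, h.comm_fork le_rfl]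
  refine h1.of_smul ?_ ?_
  · rintro _ ⟨i, hi, -, rfl⟩
    refine ⟨δ, δ⁻¹ • e i, ?_, (smul_inv_smul₀ hδ _).symm⟩
    have hi : i = 0 ∨ i = 1 := by omega
    rcases hi with rfl | rfl <;> simp
  · intro t ht
    have ht : t = δ⁻¹ • e 1 ∨ t = δ⁻¹ • e 0 := by simpa using ht
    rcases ht with rfl | rfl
    · exact ⟨δ⁻¹, e 1, ⟨1, by omega, le_rfl, rfl⟩, rfl⟩
    · exact ⟨δ⁻¹, e 0, ⟨0, by omega, le_rfl, rfl⟩, rfl⟩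

/-- Each generator factors through any generator further along the diagram. -/
theorem TLSys.killed_of_last (h : TLSys δ n e) {m : ℕ} (hm : 1 ≤ m) (hmn : m + 1 < n)
    {Y : Set M} (hY : ∀ i < m + 2, ∀ y ∈ Y, e i y ∈ Y) (hl : ∀ y ∈ Y, e (m + 1) y = 0) :
    ∀ i < m + 2, ∀ y ∈ Y, e i y = 0 := by
  have key : ∀ j, 1 ≤ m + 1 - j → ∀ y ∈ Y, e (m + 1 - j) y = 0 := by
    intro j
    induction j with
    | zero => exact fun _ => hl
    | succ j ih =>
      intro hj y hy
      obtain ⟨i, hi⟩ : ∃ i, m + 1 - (j + 1) = i := ⟨_, rfl⟩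
      have hi' : m + 1 - j = i + 1 := by omega
      rw [hi]
      rw [hi'] at ih
      rw [← h.up_down (show 1 ≤ i by omega) (by omega), Module.End.mul_apply,
        Module.End.mul_apply, ih (by omega) _ (hY i (by omega) y hy), map_zero]
  intro i hi y hy
  rcases Nat.eq_zero_or_pos i with rfl | hi0
  · have h2 := key (m + 1 - 2) (by omega)
    rw [show m + 1 - (m + 1 - 2) = 2 by omega] at h2
    rw [← h.zero_two (by omega), Module.End.mul_apply,
        Module.End.mul_apply, h2 _ (hY 0 (by omega) y hy), map_zero]
  · have := key (m + 1 - i) (by omega) y hy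
    rwa [show m + 1 - (m + 1 - i) = i by omega] at this

/-- Dual to `TLSys.killed_of_last`: every generator lies in the two-sided ideal of the last one. -/
theorem TLSys.mem_of_last (h : TLSys δ n e) {m : ℕ} (hm : 1 ≤ m) (hmn : m + 1 < n)
    {S : Submodule R M} (hS : ∀ a ∈ tlAlg R e (m + 2), ∀ x, a (e (m + 1) x) ∈ S) :
    ∀ i < m + 2, ∀ x, e i x ∈ S := by
  have hmem : ∀ i < m + 2, e i ∈ tlAlg R e (m + 2) := fun i hi => tlAlg_mem R (by omega) hi
  have key : ∀ j, 1 ≤ m + 1 - j → ∀ a ∈ tlAlg R e (m + 2), ∀ x, a (e (m + 1 - j) x) ∈ S := by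
    intro j
    induction j with
    | zero => exact fun _ => hS
    | succ j ih =>
      intro hj a ha x
      obtain ⟨i, hi⟩ : ∃ i, m + 1 - (j + 1) = i := ⟨_, rfl⟩
      have hi' : m + 1 - j = i + 1 := by omega
      rw [hi]
      rw [hi'] at ih
      rw [← h.up_down (show 1 ≤ i by omega) (by omega)]
      exact ih (by omega) (a * e i) (mul_mem ha (hmem i (by omega))) (e i x)
  intro i hi x
  rcases Nat.eq_zero_or_pos i with rfl | hi0
  · have h2 := key (m + 1 - 2) (by omega) (e 0) (hmem 0 hi) (e 0 x)
    rw [show m + 1 - (m + 1 - 2) = 2 by omega] at h2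
    rw [← h.zero_two (by omega)]
    exact h2
  · have := key (m + 1 - i) (by omega) 1 (one_mem _) x
    rwa [show m + 1 - (m + 1 - i) = i by omega] at this

/-- The induction goes down by two because the corner at the last generator involves two generators
fewer; hence the two base cases. The part of the module invisible to that corner is the range of the
Jones–Wenzl projection. -/
theorem TLSys.stablyComplemented_of_fork (h : TLSys δ n e) (hf : ForkRel κ e) (hδ : δ ≠ 0)
    (hμ : μ * (δ + κ) = 1) (hn : 1 ≤ n) (hτ : ∀ k, 2 ≤ k → k < n → tau δ μ k ≠ 0) :
    StablyComplemented (tlGen e n) := by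
  induction n using Nat.strong_induction_on with
  | _ n ih =>
    match n, hn, ih with
    | 1, _, _ =>
      have h1 : tlGen e 1 = ∅ := by
        ext x
        simp [tlGen]
      rw [h1]
      exact stablyComplemented_empty
    | 2, _, _ => exact h.stablyComplemented_two hδ
    | m + 3, _, ih =>
      have hB := ih (m + 1) (by omega) (h.mono (by omega)) (by omega)
        fun k hk hkm => hτ k hk (by omega)
      have hj := (isJonesWenzl_and_through h hf hμ (show 2 ≤ m + 3 by omega) le_rfl hτ).1
      have hmem : ∀ i < m + 3, e i ∈ tlAlg R e (m + 3) := fun i hi => tlAlg_mem R (by omega) hi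
      refine hB.of_corner (e := e (m + 2)) (f := jonesWenzl δ μ e (m + 3))
        (hmem _ (by omega)) (jonesWenzl_mem _ _ _ _) hj.idem ?_ ?_ ?_ ?_ ?_
        ⟨m + 2, by omega, by omega, rfl⟩ ?_ ?_
      · rintro _ ⟨i, hi, h2, rfl⟩
        exact hmem i (by omega)
      · rintro _ ⟨i, hi, h2, rfl⟩
        exact h.commute_far (by omega) (by omega) (by omega)
      · exact fun a ha => h.corner_last hf (by omega) le_rfl ha
      · rintro _ ⟨i, hi, h2, rfl⟩
        exact hj.left i hi
      · rintro _ ⟨i, hi, h2, rfl⟩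
        exact hj.right i hi
      · intro y hy
        refine jonesWenzl_apply_of_killed δ μ fun i hi => ?_
        -- This set is stable under the generators and killed by the last one, hence by all of them.
        refine h.killed_of_last (m := m + 1) (Y := {y | ∀ a ∈ tlAlg R e (m + 3), e (m + 2) (a y) = 0})
          (by omega) (by omega) ?_ ?_ i hi y hy
        · intro i hi y hy a ha
          exact hy (a * e i) (mul_mem ha (hmem i hi))
        · intro y hy
          exact hy 1 (one_mem _)
      · intro S hS x
        have := S.neg_mem (jonesWenzl_apply_sub_mem δ μ
          (h.mem_of_last (m := m + 1) (by omega) (by omega) hS) x)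
        rwa [neg_sub] at this

end Sufficiency

/-! ### Splitting the generators along the fork -/

/-- The ideal generated by the product of the two fork generators is a copy of the augmentation
ideal of a type `A` Temperley–Lieb algebra; these are the images of its generators. -/
def forkWord {R A : Type*} [Field R] [Ring A] [Algebra R A] (δ : R) (e : ℕ → A) : ℕ → A
  -- In the quotient `e 0 = e 1` this becomes `e 0`, and all the words become the generators; in the
  -- quotient `e 0 * e 1 = 0` they vanish.
  | 0 => δ⁻¹ • (e 0 * e 1)
  | 1 => δ⁻¹ • (e 0 * e 1)
  | m + 2 => e (m + 2) * forkWord δ e (m + 1) * e (m + 2)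

section ForkWord

variable {R A : Type*} [Field R] [Ring A] [Algebra R A] {δ : R} {n : ℕ} {e : ℕ → A}

theorem forkWord_mem (δ : R) (e : ℕ → A) {i k : ℕ} (h2 : 2 ≤ k) (hik : i < k) :
    forkWord δ e i ∈ tlAlg R e k := by
  have h0 : ∀ i < 2, e i ∈ tlAlg R e k := fun i hi => tlAlg_mem R h2 (by omega)
  have hb : δ⁻¹ • (e 0 * e 1) ∈ tlAlg R e k :=
    Subalgebra.smul_mem _ (mul_mem (h0 0 (by omega)) (h0 1 (by omega))) _
  induction i with
  | zero => exact hb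
  | succ i ih =>
    match i, ih with
    | 0, _ => exact hb
    | i + 1, ih =>
      exact mul_mem (mul_mem (tlAlg_mem R h2 hik) (ih (by omega))) (tlAlg_mem R h2 hik)

theorem TLSys.forkWord_commute (h : TLSys δ n e) {i j : ℕ} (hij : i + 2 ≤ j) (hj3 : 3 ≤ j)
    (hj : j < n) : forkWord δ e i * e j = e j * forkWord δ e i :=
  h.commute_tlAlg (m := max 2 (i + 1)) (by omega) hj (forkWord_mem δ e (by omega) (by omega))

theorem TLSys.mul_forkWord_self (h : TLSys δ n e) {i : ℕ} (hi : i < n) (hn : 2 ≤ n) :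
    e i * forkWord δ e i = δ • forkWord δ e i ∧ forkWord δ e i * e i = δ • forkWord δ e i := by
  match i with
  | 0 =>
    simp only [forkWord]
    constructor
    · rw [mul_smul_comm, ← mul_assoc, h.sq 0 hi, smul_mul_assoc, smul_comm]
    · rw [smul_mul_assoc, mul_assoc, h.comm_fork hn, ← mul_assoc, h.sq 0 hi, smul_mul_assoc,
        smul_comm]
  | 1 =>
    simp only [forkWord]
    constructor
    · rw [mul_smul_comm, ← mul_assoc, h.comm_fork hn, mul_assoc, h.sq 1 hi, mul_smul_comm,
        smul_comm]
    · rw [smul_mul_assoc, mul_assoc, h.sq 1 hi, mul_smul_comm, smul_comm]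
  | i + 2 =>
    simp only [forkWord]
    constructor
    · rw [← mul_assoc, ← mul_assoc, h.sq _ hi]
      simp only [smul_mul_assoc]
    · rw [mul_assoc, h.sq _ hi, mul_smul_comm]

/-- Conjugating a neighbouring word: the facts about `a * w * a` when `a` and `b` are adjacent and
`w` is absorbed by `b`. -/
theorem conj_adjacent (hδ : δ ≠ 0) {a b w : A} (hab : b * a * b = b) (hl : b * w = δ • w)
    (hr : w * b = δ • w) : (a * w * a) * b = a * w ∧ b * (a * w * a) = w * a ∧
      w * a * w = δ⁻¹ • (w * w) := by
  have hl' : w = δ⁻¹ • (b * w) := by rw [hl, inv_smul_smul₀ hδ]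
  have hr' : w = δ⁻¹ • (w * b) := by rw [hr, inv_smul_smul₀ hδ]
  have h1 : w * a * b = w := by
    calc w * a * b = δ⁻¹ • (w * b) * a * b := by rw [← hr']
      _ = δ⁻¹ • (w * (b * a * b)) := by simp only [smul_mul_assoc, mul_assoc]
      _ = w := by rw [hab, ← hr']
  have h2 : b * a * w = w := by
    calc b * a * w = b * a * (δ⁻¹ • (b * w)) := by rw [← hl']
      _ = δ⁻¹ • (b * a * b * w) := by simp only [mul_smul_comm, mul_assoc]
      _ = w := by rw [hab, ← hl']
  refine ⟨?_, ?_, ?_⟩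
  · rw [mul_assoc, mul_assoc, ← mul_assoc w, h1]
  · rw [← mul_assoc, ← mul_assoc, h2]
  · calc w * a * w = w * a * (δ⁻¹ • (b * w)) := by rw [← hl']
      _ = δ⁻¹ • (w * a * b * w) := by simp only [mul_smul_comm, mul_assoc]
      _ = δ⁻¹ • (w * w) := by rw [h1]

/-- For `j` adjacent to `m + 2`, conjugating the `j`-th word gives the next one. -/
theorem forkWord_step (δ : R) (e : ℕ → A) {m j : ℕ} (hj : j ≤ m + 1) (hadj : AdjD j (m + 2)) :
    forkWord δ e (m + 2) = e (m + 2) * forkWord δ e j * e (m + 2) := by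
  unfold AdjD at hadj
  have : j = m + 1 ∨ (j = 0 ∧ m = 0) := by omega
  rcases this with rfl | ⟨rfl, rfl⟩ <;> rfl

/-- This exchange law is the source of all the relations among the words. The induction is on the
larger index. -/
theorem TLSys.mul_forkWord_comm (h : TLSys δ n e) (hδ : δ ≠ 0) (hn : 2 ≤ n) {m : ℕ} (hm : m < n) :
    ∀ i j, i ≤ m → j ≤ m → e i * forkWord δ e j = forkWord δ e i * e j := by
  have hs := fun i (hi : i < n) => h.mul_forkWord_self hi hn
  induction m with
  | zero =>
    intro i j hi hj
    obtain rfl : i = 0 := by omega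
    obtain rfl : j = 0 := by omega
    rw [(hs 0 hm).1, (hs 0 hm).2]
  | succ m ih =>
    match m, ih with
    | 0, _ =>
      have h0 := hs 0 (by omega)
      have h1 := hs 1 (by omega)
      have h01 : forkWord δ e 0 = forkWord δ e 1 := rfl
      intro i j hi hj
      have hi : i = 0 ∨ i = 1 := by omega
      have hj : j = 0 ∨ j = 1 := by omega
      rw [h01] at h0
      rcases hi with rfl | rfl <;> rcases hj with rfl | rfl <;>
        simp only [h01, h0.1, h0.2, h1.1, h1.2]
    | m + 1, ih =>
      have key : ∀ j, j ≤ m + 1 → e (m + 2) * forkWord δ e j = forkWord δ e (m + 2) * e j ∧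
          e j * forkWord δ e (m + 2) = forkWord δ e j * e (m + 2) := by
        intro j hj
        by_cases hadj : AdjD j (m + 2)
        · have hw := conj_adjacent hδ (h.adj j (m + 2) (by omega) hm hadj) (hs j (by omega)).1
            (hs j (by omega)).2
          rw [forkWord_step δ e hj hadj]
          exact ⟨hw.1.symm, hw.2.1⟩
        · have hjm : j + 1 < m + 2 ∧ 3 ≤ m + 2 := by unfold AdjD at hadj; omega
          -- For a far index, replace e_{m+2} by e_{m+2} e_{m+1} e_{m+2}, so that one factor passes
          -- the word and the law for `m + 1` applies.
          have c1 := h.comm j (m + 2) (by omega) hm hadj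
          have c2 := h.forkWord_commute (show j + 2 ≤ m + 2 by omega) hjm.2 hm
          have hd := h.down_up (show 1 ≤ m + 1 by omega) hm
          simp only [forkWord]
          constructor
          · calc e (m + 2) * forkWord δ e j
                = e (m + 2) * e (m + 1) * (e (m + 2) * forkWord δ e j) := by
                  rw [← mul_assoc, hd]
              _ = e (m + 2) * (e (m + 1) * forkWord δ e j) * e (m + 2) := by
                  rw [← c2]; simp only [mul_assoc]
              _ = e (m + 2) * forkWord δ e (m + 1) * (e j * e (m + 2)) := by
                  rw [ih (by omega) _ _ le_rfl hj]; simp only [mul_assoc]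
              _ = _ := by rw [c1]; simp only [mul_assoc]
          · calc e j * (e (m + 2) * forkWord δ e (m + 1) * e (m + 2))
                = e (m + 2) * (e j * forkWord δ e (m + 1)) * e (m + 2) := by
                  rw [← mul_assoc, ← mul_assoc, c1]; simp only [mul_assoc]
              _ = (e (m + 2) * forkWord δ e j) * e (m + 1) * e (m + 2) := by
                  rw [ih (by omega) _ _ hj le_rfl]; simp only [mul_assoc]
              _ = forkWord δ e j * (e (m + 2) * e (m + 1) * e (m + 2)) := by
                  rw [← c2]; simp only [mul_assoc]
              _ = _ := by rw [hd]
      intro i j hi hj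
      rcases Nat.le_succ_iff.1 hi with hi | rfl <;> rcases Nat.le_succ_iff.1 hj with hj | rfl
      · exact ih (by omega) i j hi hj
      · exact (key i hi).2
      · exact (key j hj).1
      · rw [(hs _ hm).1, (hs _ hm).2]

theorem TLSys.forkWord_sq (h : TLSys δ n e) (hδ : δ ≠ 0) (hn : 2 ≤ n) {i : ℕ} (hi : i < n) :
    forkWord δ e i * forkWord δ e i = δ • forkWord δ e i := by
  have hbase : (δ⁻¹ • (e 0 * e 1)) * (δ⁻¹ • (e 0 * e 1)) = δ • δ⁻¹ • (e 0 * e 1) := by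
    rw [smul_mul_smul_comm, mul_assoc, ← mul_assoc (e 1), h.comm_fork hn, mul_assoc,
      ← mul_assoc (e 0) (e 0), h.sq 0 (by omega), h.sq 1 (by omega), smul_mul_smul_comm]
    simp only [smul_smul]
    congr 1
    field_simp
  induction i with
  | zero => exact hbase
  | succ i ih =>
    match i, ih with
    | 0, _ => exact hbase
    | i + 1, ih =>
      have hs := h.mul_forkWord_self (show i + 1 < n by omega) hn
      have hw := (conj_adjacent hδ (h.up_down (by omega) hi) hs.1 hs.2).2.2
      rw [ih (by omega), inv_smul_smul₀ hδ] at hw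
      simp only [forkWord]
      calc e (i + 2) * forkWord δ e (i + 1) * e (i + 2) *
            (e (i + 2) * forkWord δ e (i + 1) * e (i + 2))
          = e (i + 2) * forkWord δ e (i + 1) * (e (i + 2) * e (i + 2)) * forkWord δ e (i + 1) *
              e (i + 2) := by simp only [mul_assoc]
        _ = δ • (e (i + 2) * (forkWord δ e (i + 1) * e (i + 2) * forkWord δ e (i + 1)) *
              e (i + 2)) := by
          rw [h.sq _ hi]; simp only [mul_smul_comm, smul_mul_assoc, mul_assoc]
        _ = _ := by rw [hw]

/-- Multiplying by δ = 0 is excluded, so it can be cancelled: δ w_i e_j = w_i w_i e_j = w_i e_i w_j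
= δ w_i w_j. Consequently the words and the differences `e i - w i` annihilate each other. -/
theorem TLSys.forkWord_mul (h : TLSys δ n e) (hδ : δ ≠ 0) (hn : 2 ≤ n) {i j : ℕ} (hi : i < n)
    (hj : j < n) :
    forkWord δ e i * e j = forkWord δ e i * forkWord δ e j ∧
      e i * forkWord δ e j = forkWord δ e i * forkWord δ e j := by
  have hc := h.mul_forkWord_comm hδ hn (show max i j < n by omega) i j (by omega) (by omega)
  have h1 : forkWord δ e i * e j = forkWord δ e i * forkWord δ e j := by
    apply smul_right_injective A hδ
    calc δ • (forkWord δ e i * e j) = forkWord δ e i * (forkWord δ e i * e j) := by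
          rw [← mul_assoc, h.forkWord_sq hδ hn hi, smul_mul_assoc]
      _ = δ • (forkWord δ e i * forkWord δ e j) := by
          rw [← hc, ← mul_assoc, (h.mul_forkWord_self hi hn).2, smul_mul_assoc]
  exact ⟨h1, hc.trans h1⟩

theorem TLSys.forkWord_comm (h : TLSys δ n e) (hδ : δ ≠ 0) (hn : 2 ≤ n) {i j : ℕ} (hi : i < n)
    (hj : j < n) (hij : ¬ AdjD i j) :
    forkWord δ e i * forkWord δ e j = forkWord δ e j * forkWord δ e i := by
  have hs := h.mul_forkWord_self hj hn
  apply smul_right_injective A hδ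
  calc δ • (forkWord δ e i * forkWord δ e j)
      = e i * (e j * forkWord δ e j) := by
        rw [hs.1, mul_smul_comm, (h.forkWord_mul hδ hn hi hj).2]
    _ = e j * (forkWord δ e i * e j) := by
        rw [← mul_assoc, h.comm i j hi hj hij, mul_assoc, (h.forkWord_mul hδ hn hi hj).2,
          (h.forkWord_mul hδ hn hi hj).1]
    _ = forkWord δ e j * (e i * e j) := by
        rw [← mul_assoc, (h.forkWord_mul hδ hn hj hi).2, ← (h.forkWord_mul hδ hn hj hi).1, mul_assoc]
    _ = δ • (forkWord δ e j * forkWord δ e i) := by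
        rw [h.comm i j hi hj hij, ← mul_assoc, hs.2, smul_mul_assoc,
          (h.forkWord_mul hδ hn hj hi).1]

theorem TLSys.forkWord_adj (h : TLSys δ n e) (hδ : δ ≠ 0) (hn : 2 ≤ n) {i j : ℕ} (hi : i < n)
    (hj : j < n) (hij : AdjD i j) :
    forkWord δ e i * forkWord δ e j * forkWord δ e i = forkWord δ e i := by
  have hs := h.mul_forkWord_self hi hn
  apply smul_right_injective A hδ
  calc δ • (forkWord δ e i * forkWord δ e j * forkWord δ e i)
      = e i * e j * (e i * forkWord δ e i) := by
        rw [hs.1, mul_smul_comm, mul_assoc (e i), (h.forkWord_mul hδ hn hj hi).2, ← mul_assoc,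
          (h.forkWord_mul hδ hn hi hj).2]
    _ = δ • forkWord δ e i := by rw [← mul_assoc, h.adj i j hi hj hij, hs.1]

theorem TLSys.forkWord_tlSys (h : TLSys δ n e) (hδ : δ ≠ 0) (hn : 2 ≤ n) :
    TLSys δ n (forkWord δ e) where
  sq _ hi := h.forkWord_sq hδ hn hi
  comm _ _ hi hj hij := h.forkWord_comm hδ hn hi hj hij
  adj _ _ hi hj hij := h.forkWord_adj hδ hn hi hj hij

theorem TLSys.sub_forkWord_mul (h : TLSys δ n e) (hδ : δ ≠ 0) (hn : 2 ≤ n) {i j : ℕ} (hi : i < n)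
    (hj : j < n) : (e i - forkWord δ e i) * (e j - forkWord δ e j) =
      e i * e j - forkWord δ e i * forkWord δ e j := by
  have hw := h.forkWord_mul hδ hn hi hj
  rw [sub_mul, mul_sub, mul_sub, hw.1, hw.2]
  abel

theorem TLSys.sub_forkWord (h : TLSys δ n e) (hδ : δ ≠ 0) (hn : 2 ≤ n) :
    TLSys δ n fun i => e i - forkWord δ e i where
  sq i hi := by rw [h.sub_forkWord_mul hδ hn hi hi, h.sq i hi, h.forkWord_sq hδ hn hi, smul_sub]
  comm i j hi hj hij := by
    rw [h.sub_forkWord_mul hδ hn hi hj, h.sub_forkWord_mul hδ hn hj hi, h.comm i j hi hj hij,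
      h.forkWord_comm hδ hn hi hj hij]
  adj i j hi hj hij := by
    have hw := h.forkWord_mul hδ hn hi hj
    have hw' := h.forkWord_mul hδ hn hj hi
    rw [h.sub_forkWord_mul hδ hn hi hj, sub_mul, mul_sub, mul_sub, h.adj i j hi hj hij,
      h.forkWord_adj hδ hn hi hj hij, mul_assoc (e i), hw'.2, ← mul_assoc (e i), hw.2,
      h.forkWord_adj hδ hn hi hj hij, mul_assoc _ _ (e i), hw'.1, ← mul_assoc,
      h.forkWord_adj hδ hn hi hj hij]
    abel

theorem TLSys.forkRel_forkWord (h : TLSys δ n e) (hδ : δ ≠ 0) (hn : 2 ≤ n) :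
    ForkRel δ (forkWord δ e) :=
  ⟨h.forkWord_sq hδ hn (i := 0) (by omega), h.forkWord_sq hδ hn (i := 0) (by omega)⟩

theorem TLSys.forkRel_sub_forkWord (h : TLSys δ n e) (hδ : δ ≠ 0) (hn : 2 ≤ n) :
    ForkRel (0 : R) fun i => e i - forkWord δ e i := by
  have h0 : (e 0 - forkWord δ e 0) * (e 1 - forkWord δ e 1) = 0 := by
    rw [h.sub_forkWord_mul hδ hn (by omega) (by omega), (h.forkRel_forkWord hδ hn).1]
    simp only [forkWord, smul_inv_smul₀ hδ, sub_self]
  exact ⟨by rw [h0, zero_smul], by rw [h0, zero_smul]⟩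

end ForkWord

/-! ### Gluing the two quotients -/

section Splitting

variable {R M : Type*} [Field R] [AddCommGroup M] [Module R M] {δ : R} {n : ℕ}
  {e : ℕ → Module.End R M}

/-- The Jones–Wenzl projection `f` of the fork words satisfies f e_j = e_j f = e_j - w_j. So `e j`
acts as `e j - w j` on the range of `f` and as `w j` on the range of `1 - f`, and the fork case
applies to each. -/
theorem TLSys.stablyComplemented (h : TLSys δ n e) (hn : 2 ≤ n) (h2 : (2 : R) ≠ 0) (hδ : δ ≠ 0)
    (hA : ∀ k, 2 ≤ k → k < n → tau δ (2 * δ)⁻¹ k ≠ 0)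
    (hD : ∀ k, 2 ≤ k → k < n → tau δ δ⁻¹ k ≠ 0) : StablyComplemented (tlGen e n) := by
  set w := forkWord δ e with hw
  have hsys : TLSys δ n w := h.forkWord_tlSys hδ hn
  have hμ : (2 * δ)⁻¹ * (δ + δ) = 1 := by rw [← two_mul, inv_mul_cancel₀ (mul_ne_zero h2 hδ)]
  have hcA := hsys.stablyComplemented_of_fork (h.forkRel_forkWord hδ hn) hδ hμ (by omega) hA
  have hcD := (h.sub_forkWord hδ hn).stablyComplemented_of_fork (h.forkRel_sub_forkWord hδ hn) hδ
    (by rw [add_zero, inv_mul_cancel₀ hδ]) (by omega) hD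
  have hj := (isJonesWenzl_and_through hsys (h.forkRel_forkWord hδ hn) hμ hn le_rfl hA).1
  -- The words kill the image of `e j - w j`, so `f` is the identity there. Dually, `e j - w j`
  -- kills the images of the words, hence that of `f - 1`.
  have hfe' : ∀ j < n, ∀ x, jonesWenzl δ (2 * δ)⁻¹ w n (e j x - w j x) = e j x - w j x := by
    intro j hjn x
    refine jonesWenzl_apply_of_killed _ _ fun i hi => ?_
    have := LinearMap.congr_fun (h.forkWord_mul hδ hn hi hjn).1 x
    simp only [Module.End.mul_apply] at this
    rw [map_sub, this, sub_self]
  have hef' : ∀ j < n, ∀ x, e j (jonesWenzl δ (2 * δ)⁻¹ w n x - x) =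
      w j (jonesWenzl δ (2 * δ)⁻¹ w n x - x) := by
    intro j hjn x
    have := jonesWenzl_apply_sub_mem (e := w) (m := n) δ (2 * δ)⁻¹ (S := LinearMap.ker (e j - w j))
      (fun i hi y => by
        have := LinearMap.congr_fun (h.forkWord_mul hδ hn hjn hi).2 y
        rw [LinearMap.mem_ker, LinearMap.sub_apply, sub_eq_zero]
        exact this) x
    rwa [LinearMap.mem_ker, LinearMap.sub_apply, sub_eq_zero] at this
  have hmem : jonesWenzl δ (2 * δ)⁻¹ w n ∈ tlAlg R e n := by
    refine Algebra.adjoin_le (S := tlAlg R e n) ?_ (jonesWenzl_mem δ (2 * δ)⁻¹ w n)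
    rintro _ ⟨i, hi, -, rfl⟩
    exact forkWord_mem δ e hn hi
  generalize jonesWenzl δ (2 * δ)⁻¹ w n = f at hj hfe' hef' hmem
  have hfw : ∀ j < n, ∀ x, f (w j x) = 0 := fun j hjn x => LinearMap.congr_fun (hj.right j hjn) x
  have hwf : ∀ j < n, ∀ x, w j (f x) = 0 := fun j hjn x => LinearMap.congr_fun (hj.left j hjn) x
  have hfe : ∀ j < n, ∀ x, f (e j x) = e j x - w j x := fun j hjn x => by
    have := hfe' j hjn x
    rwa [map_sub, hfw j hjn, sub_zero] at this
  have hef : ∀ j < n, ∀ x, e j (f x) = e j x - w j x := fun j hjn x => by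
    have := hef' j hjn x
    rw [map_sub, map_sub, hwf j hjn, zero_sub] at this
    rw [sub_eq_iff_eq_add.1 this]
    abel
  have hff : ∀ x, f (f x) = f x := fun x => LinearMap.congr_fun hj.idem x
  have hff' : (1 - f) * (1 - f) = 1 - f := by
    rw [mul_sub, sub_mul, sub_mul, hj.idem]; simp
  intro N hN
  have hfN : ∀ x ∈ N, f x ∈ N := fun x hx => hN.adjoin hmem hx
  have heN : ∀ i < n, ∀ x ∈ N, e i x ∈ N := fun i hi => hN _ ⟨i, hi, hn, rfl⟩
  have hwN : Stable (tlGen w n) (N.map (1 - f)) := by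
    rintro _ ⟨i, hi, -, rfl⟩ _ ⟨x, hx, rfl⟩
    refine ⟨e i x, heN i hi x hx, ?_⟩
    simp only [LinearMap.sub_apply, Module.End.one_apply, map_sub, hfe i hi, hwf i hi]
    abel
  have hdN : Stable (tlGen (fun i => e i - w i) n) (N.map f) := by
    rintro _ ⟨i, hi, -, rfl⟩ _ ⟨x, hx, rfl⟩
    refine ⟨e i x, heN i hi x hx, ?_⟩
    simp only [LinearMap.sub_apply, hfe i hi, hwf i hi, hef i hi, sub_zero]
  obtain ⟨C₁, hC₁, hi₁⟩ := hcD _ hdN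
  obtain ⟨C₂, hC₂, hi₂⟩ := hcA _ hwN
  obtain ⟨d₁, s₁⟩ := exists_complement_in_range hj.idem hi₁
  obtain ⟨d₂, s₂⟩ := exists_complement_in_range hff' hi₂
  have hm₁ : N.map f ≤ N := by rintro _ ⟨x, hx, rfl⟩; exact hfN x hx
  have hm₂ : N.map (1 - f) ≤ N := by rintro _ ⟨x, hx, rfl⟩; exact N.sub_mem hx (hfN x hx)
  have k₁ : ∀ x ∈ C₁ ⊓ LinearMap.range f, f x = x := by
    rintro _ ⟨-, y, rfl⟩
    exact hff y
  have k₂ : ∀ x ∈ C₂ ⊓ LinearMap.range (1 - f), f x = 0 := by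
    rintro _ ⟨-, y, rfl⟩
    rw [LinearMap.sub_apply, map_sub, hff, Module.End.one_apply, sub_self]
  refine ⟨C₁ ⊓ LinearMap.range f ⊔ C₂ ⊓ LinearMap.range (1 - f), ?_,
    isCompl_sup_of_idempotent hfN k₁ k₂ d₁ d₂ (fun x => sup_le_sup_right hm₁ _ (s₁ x))
      (fun x => sup_le_sup_right hm₂ _ (s₂ x))⟩
  rintro _ ⟨i, hi, -, rfl⟩ x hx
  obtain ⟨y, hy, z, hz, rfl⟩ := Submodule.mem_sup.1 hx
  rw [map_add]
  refine Submodule.add_mem_sup ?_ ?_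
  · have hy' : e i y = (e i - w i) y := by
      rw [LinearMap.sub_apply, ← k₁ y hy, hwf i hi, sub_zero]
    refine ⟨hy' ▸ hC₁ _ ⟨i, hi, hn, rfl⟩ y hy.1, e i y, ?_⟩
    rw [hfe i hi]
    exact hy'.symm
  · have hz' : e i z = w i z := by
      have := hef i hi z
      rwa [k₂ z hz, map_zero, eq_comm, sub_eq_zero] at this
    refine ⟨hz' ▸ hC₂ _ ⟨i, hi, hn, rfl⟩ z hz.1, e i z, ?_⟩
    rw [LinearMap.sub_apply, hfe i hi, Module.End.one_apply, hz']
    abel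

end Splitting

/-! ### Cup-cap operators on words in four letters -/

section Words

/-- The letter paired with a given letter by the bilinear form. -/
def barLetter (x : Bool × Bool) : Bool × Bool := (x.1, !x.2)

@[simp] theorem barLetter_bar (x : Bool × Bool) : barLetter (barLetter x) = x := by
  simp [barLetter]

theorem barLetter_ne (x : Bool × Bool) : barLetter x ≠ x := by
  rcases x with ⟨a, b⟩
  cases b <;> simp [barLetter]

/-- Write the pair `x`, `barLetter x` at the places `i` and `i + 1` of a word. -/
def writePair (w : ℕ → Bool × Bool) (i : ℕ) (x : Bool × Bool) : ℕ → Bool × Bool := fun j =>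
  if j = i then x else if j = i + 1 then barLetter x else w j

variable {w : ℕ → Bool × Bool} {i j : ℕ} {x y : Bool × Bool}

@[simp] theorem writePair_left : writePair w i x i = x := by simp [writePair]

@[simp] theorem writePair_right : writePair w i x (i + 1) = barLetter x := by simp [writePair]

theorem writePair_of_ne (h : j ≠ i) (h' : j ≠ i + 1) : writePair w i x j = w j := by
  simp [writePair, h, h']

@[simp] theorem writePair_writePair : writePair (writePair w i x) i y = writePair w i y := by
  funext j
  simp only [writePair]
  split_ifs <;> rfl

theorem writePair_self (h : w (i + 1) = barLetter (w i)) : writePair w i (w i) = w := by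
  funext j
  simp only [writePair]
  split_ifs with h1 h2
  · rw [h1]
  · rw [h2, h]
  · rfl

theorem writePair_comm (h : i + 2 ≤ j) :
    writePair (writePair w i x) j y = writePair (writePair w j y) i x := by
  funext k
  simp only [writePair]
  split_ifs <;> first | rfl | omega

variable {R K : Type*} [Field R] [Field K] [Algebra R K] {q : K} {s s' : Bool × Bool → K}

/-- The values of the bilinear form. -/
def letterWeight (q : K) (x : Bool × Bool) : K := if x.2 then 1 else q

theorem letterWeight_ne_zero (hq : q ≠ 0) (x : Bool × Bool) : letterWeight q x ≠ 0 := by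
  unfold letterWeight
  split_ifs <;> simp [hq]

/-- The cup-cap operator at the places `i` and `i + 1`, decorated by `s`, on functions on words. -/
def cupCap (R : Type*) [Field R] [Algebra R K] (q : K) (s : Bool × Bool → K) (i : ℕ) :
    Module.End R ((ℕ → Bool × Bool) → K) where
  toFun F w := if w (i + 1) = barLetter (w i) then
    s (w i) * (letterWeight q (barLetter (w i)))⁻¹ *
      ∑ x, s x * letterWeight q x * F (writePair w i x) else 0
  map_add' F G := by
    funext w
    simp only [Pi.add_apply, mul_add, Finset.sum_add_distrib]
    split_ifs <;> simp
  map_smul' r F := by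
    funext w
    simp only [Pi.smul_apply, mul_smul_comm, RingHom.id_apply, ← Finset.smul_sum]
    split_ifs <;> simp

theorem cupCap_apply (F : (ℕ → Bool × Bool) → K) (w : ℕ → Bool × Bool) :
    cupCap R q s i F w = if w (i + 1) = barLetter (w i) then
      s (w i) * (letterWeight q (barLetter (w i)))⁻¹ *
        ∑ x, s x * letterWeight q x * F (writePair w i x) else 0 := rfl

theorem cupCap_apply_of_ne (F : (ℕ → Bool × Bool) → K) (h : w (i + 1) ≠ barLetter (w i)) :
    cupCap R q s i F w = 0 := if_neg h

theorem cupCap_apply_of_eq (F : (ℕ → Bool × Bool) → K) (h : w (i + 1) = barLetter (w i)) :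
    cupCap R q s i F w = s (w i) * (letterWeight q (barLetter (w i)))⁻¹ *
      ∑ x, s x * letterWeight q x * F (writePair w i x) := if_pos h

/-- If a single letter contributes to the sum, only its term remains. -/
theorem cupCap_apply_of_unique (F : (ℕ → Bool × Bool) → K) (h : w (i + 1) = barLetter (w i))
    (y : Bool × Bool) (hF : ∀ x, x ≠ y → F (writePair w i x) = 0) :
    cupCap R q s i F w = s (w i) * (letterWeight q (barLetter (w i)))⁻¹ *
      (s y * letterWeight q y * F (writePair w i y)) := by
  rw [cupCap_apply_of_eq F h, Finset.sum_eq_single y]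
  · intro x _ hx
    rw [hF x hx, mul_zero]
  · simp

theorem cupCap_apply_ne_zero (hq : q ≠ 0) (hs : ∀ x, s x ≠ 0) {F : (ℕ → Bool × Bool) → K}
    (h : w (i + 1) = barLetter (w i)) (y : Bool × Bool)
    (hF : ∀ x, x ≠ y → F (writePair w i x) = 0) (hy : F (writePair w i y) ≠ 0) :
    cupCap R q s i F w ≠ 0 := by
  rw [cupCap_apply_of_unique F h y hF]
  have h1 := letterWeight_ne_zero hq (barLetter (w i))
  have h2 := letterWeight_ne_zero hq y
  have h3 := hs y
  have h4 := hs (w i)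
  positivity

/-- The value of a closed loop carrying the decorations `s` and `s'`. -/
def loopValue (q : K) (s s' : Bool × Bool → K) : K :=
  ∑ x, s x * letterWeight q x * (s' x * (letterWeight q (barLetter x))⁻¹)

theorem cupCap_mul_same (F : (ℕ → Bool × Bool) → K) (w : ℕ → Bool × Bool) :
    cupCap R q s i (cupCap R q s' i F) w = if w (i + 1) = barLetter (w i) then
      s (w i) * (letterWeight q (barLetter (w i)))⁻¹ * loopValue q s s' *
        ∑ x, s' x * letterWeight q x * F (writePair w i x) else 0 := by
  rw [cupCap_apply]
  congr 1
  simp only [cupCap_apply, writePair_left, writePair_right, if_true, writePair_writePair]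
  rw [loopValue, mul_assoc (s (w i) * _), Finset.sum_mul]
  congr 1
  exact Finset.sum_congr rfl fun x _ => by ring

/-- A zigzag straightens: the letter at place `i + 2` leaves one surviving term in the first two
sums. The weights cancel, and each decoration occurs squared. -/
theorem cupCap_adj (hq : q ≠ 0) (hs : ∀ x, s x * s x = 1) (hs' : ∀ x, s' x * s' x = 1) :
    cupCap R q s i * cupCap R q s' (i + 1) * cupCap R q s i = cupCap R q s i := by
  refine LinearMap.ext fun F => funext fun w => ?_
  simp only [Module.End.mul_apply]
  by_cases h : w (i + 1) = barLetter (w i)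
  swap
  · rw [cupCap_apply_of_ne _ h, cupCap_apply_of_ne _ h]
  obtain ⟨b, hb⟩ : ∃ b, w (i + 2) = b := ⟨_, rfl⟩
  have hwb : ∀ x, writePair w i x (i + 1 + 1) = b := fun x => by
    rw [writePair_of_ne (by omega) (by omega), ← hb]
  rw [cupCap_apply_of_unique _ h b, cupCap_apply_of_unique _ _ (barLetter b),
    cupCap_apply_of_eq _ (by simp [writePair]), cupCap_apply_of_eq F h]
  · have hw : ∀ x, writePair (writePair (writePair w i b) (i + 1) (barLetter b)) i x =
        writePair w i x := by
      intro x
      funext k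
      have hb' : k = i + 2 → b = w k := fun hk => by rw [hk, hb]
      simp only [writePair, barLetter_bar]
      split_ifs <;> first | rfl | omega | exact hb' (by omega)
    have hi : writePair (writePair w i b) (i + 1) (barLetter b) i = b := by simp [writePair]
    simp only [hw, hi, writePair_right, barLetter_bar]
    have h1 := letterWeight_ne_zero hq b
    have h2 := letterWeight_ne_zero hq (barLetter b)
    have h3 := hs b
    have h4 := hs' (barLetter b)
    generalize (∑ x, s x * letterWeight q x * F (writePair w i x)) = t
    calc s (w i) * (letterWeight q (barLetter (w i)))⁻¹ * (s b * letterWeight q b *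
          (s' (barLetter b) * (letterWeight q b)⁻¹ * (s' (barLetter b) *
            letterWeight q (barLetter b) * (s b * (letterWeight q (barLetter b))⁻¹ * t))))
        = s (w i) * (letterWeight q (barLetter (w i)))⁻¹ * t * (s b * s b) *
            (s' (barLetter b) * s' (barLetter b)) * (letterWeight q b * (letterWeight q b)⁻¹) *
              (letterWeight q (barLetter b) * (letterWeight q (barLetter b))⁻¹) := by ring
      _ = _ := by rw [h3, h4, mul_inv_cancel₀ h1, mul_inv_cancel₀ h2]; ring
  · intro x hx
    apply cupCap_apply_of_ne
    rw [writePair_left, writePair_of_ne (by omega) (by omega), writePair_left]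
    exact hx
  · rw [hwb, writePair_right, barLetter_bar]
  · intro x hx
    apply cupCap_apply_of_ne
    rw [hwb, writePair_right, barLetter_bar]
    exact hx.symm

theorem cupCap_adj' (hq : q ≠ 0) (hs : ∀ x, s x * s x = 1) (hs' : ∀ x, s' x * s' x = 1) :
    cupCap R q s' (i + 1) * cupCap R q s i * cupCap R q s' (i + 1) = cupCap R q s' (i + 1) := by
  refine LinearMap.ext fun F => funext fun w => ?_
  simp only [Module.End.mul_apply]
  by_cases h : w (i + 1 + 1) = barLetter (w (i + 1))
  swap
  · rw [cupCap_apply_of_ne _ h, cupCap_apply_of_ne _ h]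
  obtain ⟨a, ha⟩ : ∃ a, w i = a := ⟨_, rfl⟩
  have hwa : ∀ x, writePair w (i + 1) x i = a := fun x => by
    rw [writePair_of_ne (by omega) (by omega), ← ha]
  rw [cupCap_apply_of_unique _ h (barLetter a), cupCap_apply_of_unique _ _ a,
    cupCap_apply_of_eq _ (by simp [writePair]), cupCap_apply_of_eq F h]
  · have hw : ∀ x, writePair (writePair (writePair w (i + 1) (barLetter a)) i a) (i + 1) x =
        writePair w (i + 1) x := by
      intro x
      funext k
      have ha' : k = i → a = w k := fun hk => by rw [hk, ha]
      simp only [writePair]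
      split_ifs <;> first | rfl | omega | exact ha' (by omega)
    simp only [hw, hwa, writePair_right, barLetter_bar]
    have h1 := letterWeight_ne_zero hq a
    have h2 := letterWeight_ne_zero hq (barLetter a)
    have h3 := hs a
    have h4 := hs' (barLetter a)
    generalize (∑ x, s' x * letterWeight q x * F (writePair w (i + 1) x)) = t
    calc s' (w (i + 1)) * (letterWeight q (barLetter (w (i + 1))))⁻¹ * (s' (barLetter a) *
          letterWeight q (barLetter a) * (s a * (letterWeight q (barLetter a))⁻¹ * (s a *
            letterWeight q a * (s' (barLetter a) * (letterWeight q a)⁻¹ * t))))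
        = s' (w (i + 1)) * (letterWeight q (barLetter (w (i + 1))))⁻¹ * t * (s a * s a) *
            (s' (barLetter a) * s' (barLetter a)) * (letterWeight q a * (letterWeight q a)⁻¹) *
              (letterWeight q (barLetter a) * (letterWeight q (barLetter a))⁻¹) := by ring
      _ = _ := by rw [h3, h4, mul_inv_cancel₀ h1, mul_inv_cancel₀ h2]; ring
  · intro x hx
    apply cupCap_apply_of_ne
    rw [writePair_right, writePair_of_ne (by omega) (by omega), writePair_right, barLetter_bar,
      barLetter_bar]
    exact hx.symm
  · rw [hwa, writePair_left]
  · intro x hx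
    apply cupCap_apply_of_ne
    rw [hwa, writePair_left]
    exact hx

theorem cupCap_comm (h : i + 2 ≤ j) :
    cupCap R q s i * cupCap R q s' j = cupCap R q s' j * cupCap R q s i := by
  refine LinearMap.ext fun F => funext fun w => ?_
  simp only [Module.End.mul_apply, cupCap_apply]
  have h1 : ∀ x, writePair w i x j = w j := fun x => writePair_of_ne (by omega) (by omega)
  have h2 : ∀ x, writePair w i x (j + 1) = w (j + 1) :=
    fun x => writePair_of_ne (by omega) (by omega)
  have h3 : ∀ x, writePair w j x i = w i := fun x => writePair_of_ne (by omega) (by omega)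
  have h4 : ∀ x, writePair w j x (i + 1) = w (i + 1) :=
    fun x => writePair_of_ne (by omega) (by omega)
  simp only [h1, h2, h3, h4]
  split_ifs
  · simp only [Finset.mul_sum]
    rw [Finset.sum_comm]
    refine Finset.sum_congr rfl fun x _ => Finset.sum_congr rfl fun y _ => ?_
    rw [writePair_comm h]
    ring
  all_goals simp

/-- The system of operators on words; `s` decorates the generator `e 0`. -/
def wordSys (R : Type*) [Field R] [Algebra R K] (q : K) (s : Bool × Bool → K) :
    ℕ → Module.End R ((ℕ → Bool × Bool) → K)
  | 0 => cupCap R q s 1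
  | i + 1 => cupCap R q 1 (i + 1)

/-- Each of the two blocks of letters contributes q + q⁻¹. -/
theorem loopValue_self (hs : ∀ x, s x * s x = 1) : loopValue q s s = 2 * (q + q⁻¹) := by
  have : loopValue q s s = ∑ x, letterWeight q x * (letterWeight q (barLetter x))⁻¹ :=
    Finset.sum_congr rfl fun x _ => by rw [mul_mul_mul_comm, hs, one_mul]
  simp only [this, Fintype.sum_prod_type, Fintype.sum_bool, letterWeight, barLetter]
  simp
  ring

theorem wordSys_eq (i : ℕ) :
    wordSys R q s i = cupCap R q (if i = 0 then s else 1) (max i 1) := by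
  cases i <;> simp [wordSys]

theorem cupCap_mul_eq_zero (h : loopValue q s s' = 0) : cupCap R q s i * cupCap R q s' i = 0 := by
  refine LinearMap.ext fun F => funext fun w => ?_
  rw [Module.End.mul_apply, cupCap_mul_same, h]
  simp

/-- The generators 0 and 1 occupy the same places 1 and 2. They commute because they coincide or
because both products contain a loop of value 0. -/
theorem wordSys_tlSys (hq : q ≠ 0) (hs : ∀ x, s x * s x = 1) {δ : R}
    (hs' : s = 1 ∨ loopValue q s 1 = 0 ∧ loopValue q 1 s = 0)
    (hδ : 2 * (q + q⁻¹) = algebraMap R K δ) (n : ℕ) : TLSys δ n (wordSys R q s) := by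
  have hs1 : ∀ i : ℕ, ∀ x, (if i = 0 then s else 1) x * (if i = 0 then s else 1) x = 1 := by
    intro i x
    split_ifs
    · exact hs x
    · simp
  have hmul : ∀ s s' : Bool × Bool → K, ∀ i, ∀ c : R, loopValue q s s' = algebraMap R K c →
      s = s' → cupCap R q s i * cupCap R q s' i = c • cupCap R q s i := by
    rintro s _ i c hc rfl
    refine LinearMap.ext fun F => funext fun w => ?_
    rw [Module.End.mul_apply, cupCap_mul_same, hc, LinearMap.smul_apply, Pi.smul_apply,
      cupCap_apply, Algebra.smul_def]
    split_ifs
    · ring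
    · simp
  refine ⟨fun i _ => ?_, fun i j _ _ hij => ?_, fun i j _ _ hij => ?_⟩
  · rw [wordSys_eq]
    exact hmul _ _ _ _ ((loopValue_self (hs1 i)).trans hδ) rfl
  · rw [wordSys_eq, wordSys_eq]
    unfold AdjD at hij
    have : max i 1 = max j 1 ∨ max i 1 + 2 ≤ max j 1 ∨ max j 1 + 2 ≤ max i 1 := by omega
    rcases this with h | h | h
    · rw [h]
      rcases hs' with rfl | ⟨h1, h2⟩
      · simp only [ite_self]
      · split_ifs
        · rfl
        · rw [cupCap_mul_eq_zero h1, cupCap_mul_eq_zero h2]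
        · rw [cupCap_mul_eq_zero h1, cupCap_mul_eq_zero h2]
        · rfl
    · exact cupCap_comm h
    · exact (cupCap_comm h).symm
  · rw [wordSys_eq, wordSys_eq]
    unfold AdjD at hij
    have : max j 1 = max i 1 + 1 ∨ max i 1 = max j 1 + 1 := by omega
    rcases this with h | h
    · rw [h]
      exact cupCap_adj hq (hs1 i) (hs1 j)
    · rw [h]
      exact cupCap_adj' hq (hs1 j) (hs1 i)

end Words

/-! ### Elements generating nilpotent ideals -/

section Nilpotent

variable {R A : Type*} [Field R] [Ring A] [Algebra R A] {δ κ μ : R} {n : ℕ} {e : ℕ → A}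

/-- If all operators are completely reducible, an element `z` with `z a z = 0` for all `a`
vanishes. -/
theorem StablyComplemented.eq_zero_of_sandwich {M : Type*} [AddCommGroup M] [Module R M]
    {T : Set (Module.End R M)} (hT : StablyComplemented T) {z : Module.End R M}
    (hz : z ∈ Algebra.adjoin R T) (h : ∀ a ∈ Algebra.adjoin R T, z * a * z = 0) : z = 0 := by
  refine LinearMap.ext fun x => ?_
  set N : Submodule R M := Submodule.span R {y | ∃ a ∈ Algebra.adjoin R T, y = a (z x)} with hN
  have hst : Stable T N := by
    intro t ht y hy
    induction hy using Submodule.span_induction with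
    | zero => simp
    | add x y _ _ hx hy => rw [map_add]; exact N.add_mem hx hy
    | smul r x _ hx => rw [map_smul]; exact N.smul_mem _ hx
    | mem y hy =>
      obtain ⟨a, ha, rfl⟩ := hy
      exact Submodule.subset_span ⟨t * a, mul_mem (Algebra.subset_adjoin ht) ha, rfl⟩
  have hzN : ∀ y ∈ N, z y = 0 := by
    intro y hy
    induction hy using Submodule.span_induction with
    | zero => simp
    | add x y _ _ hx hy => rw [map_add, hx, hy, add_zero]
    | smul r x _ hx => rw [map_smul, hx, smul_zero]
    | mem y hy =>
      obtain ⟨a, ha, rfl⟩ := hy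
      exact LinearMap.congr_fun (h a ha) x
  obtain ⟨C, hC, hi⟩ := hT N hst
  have hx : x ∈ N ⊔ C := hi.sup_eq_top ▸ Submodule.mem_top
  obtain ⟨y, hy, c, hc, rfl⟩ := Submodule.mem_sup.1 hx
  -- As `z` kills `N`, the vector `z x` lies both in `N` and in the stable complement.
  have hzx : z (y + c) ∈ N := Submodule.subset_span ⟨1, one_mem _, rfl⟩
  have hzc : z (y + c) ∈ C := by
    rw [map_add, hzN y hy, zero_add]
    exact hC.adjoin hz hc
  exact Submodule.disjoint_def.1 hi.disjoint _ hzx hzc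

/-- An element of square zero annihilating all generators generates a nilpotent ideal. -/
theorem sandwich_of_annihilates {m : ℕ} {z : A} (hz : ∀ i < m, z * e i = 0) (hzz : z * z = 0) :
    ∀ a ∈ tlAlg R e m, z * a * z = 0 := by
  intro a ha
  suffices h : ∃ r : R, z * a = r • z by
    obtain ⟨r, hr⟩ := h
    rw [hr, smul_mul_assoc, hzz, smul_zero]
  induction ha using Algebra.adjoin_induction with
  | mem t ht =>
    obtain ⟨i, hi, -, rfl⟩ := ht
    exact ⟨0, by rw [hz i hi, zero_smul]⟩
  | algebraMap r => exact ⟨r, by rw [← Algebra.commutes, Algebra.smul_def]⟩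
  | add a b _ _ iha ihb =>
    obtain ⟨r, hr⟩ := iha
    obtain ⟨s, hs⟩ := ihb
    exact ⟨r + s, by rw [mul_add, hr, hs, add_smul]⟩
  | mul a b _ _ iha ihb =>
    obtain ⟨r, hr⟩ := iha
    obtain ⟨s, hs⟩ := ihb
    exact ⟨r * s, by rw [← mul_assoc, hr, smul_mul_assoc, hs, mul_smul]⟩

/-- The corner reduces e_{m+1} a e_{m+1} to b e_{m+1} with b on the first m generators, where z b z
= 0 is known. The number of generators grows by two, so a starting element is needed in each parity.
-/
theorem TLSys.sandwich_extend (h : TLSys δ n e) (hf : ForkRel κ e) {m : ℕ} (hm : 1 ≤ m)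
    (hmn : m + 2 ≤ n) {z : A} (hz : z ∈ tlAlg R e m) (hzz : ∀ a ∈ tlAlg R e m, z * a * z = 0) :
    ∀ a ∈ tlAlg R e (m + 2), (e (m + 1) * z) * a * (e (m + 1) * z) = 0 := by
  intro a ha
  have hc : Commute z (e (m + 1)) := h.commute_tlAlg le_rfl (by omega) hz
  obtain ⟨b, hb, hab⟩ := h.corner_last hf hm hmn ha
  have hcb : Commute b (e (m + 1)) := h.commute_tlAlg le_rfl (by omega) hb
  calc e (m + 1) * z * a * (e (m + 1) * z)
      = z * (e (m + 1) * a * e (m + 1)) * z := by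
        conv_lhs => enter [1, 1]; rw [← hc.eq]
        simp only [mul_assoc]
    _ = e (m + 1) * (z * b * z) := by
      rw [hab, hcb.eq, ← mul_assoc, hc.eq]; simp only [mul_assoc]
    _ = 0 := by rw [hzz b hb, mul_zero]

variable {m : ℕ} {f g : A}

/-- When the next projection fails to exist, this element generates a nilpotent ideal. -/
theorem IsJonesWenzl.sandwich_one (hj : IsJonesWenzl e m f g) (ht : e m * f * e m = 0) :
    ∀ a ∈ tlAlg R e (m + 1), (f * e m * f) * a * (f * e m * f) = 0 := by
  have hlast : f * e m * f * e m = 0 := by rw [mul_assoc, mul_assoc, ← mul_assoc (e m), ht, mul_zero]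
  refine sandwich_of_annihilates (fun i hi => ?_) ?_
  · rcases Nat.lt_succ_iff_lt_or_eq.1 hi with hi | rfl
    · rw [mul_assoc, hj.right i hi, mul_zero]
    · exact hlast
  · rw [← mul_assoc, ← mul_assoc, mul_assoc (f * e m), hj.idem, hlast, zero_mul]

/-- The starting element for the other parity. It is annihilated by `e m` through e_m f e_m = 0, and
by `e (m + 1)` because e_{m+1} e_m e_{m+1} = e_{m+1} brings e_{m-1} next to f. -/
theorem IsJonesWenzl.sandwich_two (h : TLSys δ n e) (hm : 2 ≤ m) (hmn : m + 2 ≤ n)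
    (hf : f ∈ tlAlg R e m) (hj : IsJonesWenzl e m f g) (ht : e m * f * e m = 0) :
    ∀ a ∈ tlAlg R e (m + 2), (f * (e m * e (m - 1) * e (m + 1) * e m) * f) * a *
      (f * (e m * e (m - 1) * e (m + 1) * e m) * f) = 0 := by
  have hc : Commute f (e (m + 1)) := h.commute_tlAlg le_rfl (by omega) hf
  have hlast : f * (e m * e (m - 1) * e (m + 1) * e m) * f * e m = 0 := by
    calc f * (e m * e (m - 1) * e (m + 1) * e m) * f * e m
        = f * (e m * e (m - 1) * e (m + 1)) * (e m * f * e m) := by simp only [mul_assoc]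
      _ = 0 := by rw [ht, mul_zero]
  refine sandwich_of_annihilates (fun i hi => ?_) ?_
  · have : i < m ∨ i = m ∨ i = m + 1 := by omega
    rcases this with hi | rfl | rfl
    · rw [mul_assoc, hj.right i hi, mul_zero]
    · exact hlast
    · calc f * (e m * e (m - 1) * e (m + 1) * e m) * f * e (m + 1)
          = f * e m * e (m - 1) * (e (m + 1) * e m * e (m + 1)) * f := by
            rw [mul_assoc _ f, hc.eq]; simp only [mul_assoc]
        _ = f * e m * (e (m - 1) * f) * e (m + 1) := by
            rw [h.down_up (by omega) (by omega), mul_assoc, ← hc.eq]; simp only [mul_assoc]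
        _ = 0 := by rw [hj.left (m - 1) (by omega)]; simp
  · have hff : f * (e m * e (m - 1) * e (m + 1) * e m) * f * f =
        f * (e m * e (m - 1) * e (m + 1) * e m) * f := by rw [mul_assoc, hj.idem]
    calc f * (e m * e (m - 1) * e (m + 1) * e m) * f *
          (f * (e m * e (m - 1) * e (m + 1) * e m) * f)
        = f * (e m * e (m - 1) * e (m + 1) * e m) * f * f * e m *
            (e (m - 1) * e (m + 1) * e m * f) := by simp only [mul_assoc]
      _ = 0 := by rw [hff, hlast, zero_mul]

end Nilpotent

/-! ### Nonvanishing matrix coefficients -/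

section TestWords

variable {R K : Type*} [Field R] [Field K] [Algebra R K] {q : K} {s : Bool × Bool → K}
  {v : ℕ → Bool × Bool}

/-- The indicator function of a word. -/
noncomputable def wordIndicator (K : Type*) [Field K] (v : ℕ → Bool × Bool) :
    (ℕ → Bool × Bool) → K :=
  fun w => open Classical in if w = v then 1 else 0

theorem wordIndicator_of_ne {w : ℕ → Bool × Bool} {j : ℕ} (h : w j ≠ v j) :
    wordIndicator K v w = 0 :=
  if_neg fun hw => h (by rw [hw])

theorem wordIndicator_self : wordIndicator K v v = 1 := if_pos rfl

theorem cupCap_wordIndicator {i : ℕ} (h : v (i + 1) = v i) :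
    cupCap R q s i (wordIndicator K v) = 0 := by
  funext w
  rw [cupCap_apply]
  split_ifs
  · refine mul_eq_zero_of_right _ (Finset.sum_eq_zero fun x _ => mul_eq_zero_of_right _ ?_)
    by_cases hx : x = v i
    · apply wordIndicator_of_ne (j := i + 1)
      rw [writePair_right, h, hx]
      exact barLetter_ne _
    · exact wordIndicator_of_ne (j := i) (by rwa [writePair_left])
  · rfl

/-- The functions supported on the words agreeing with `v` after place `m`. -/
def tailSupported (R : Type*) [Field R] [Algebra R K] (v : ℕ → Bool × Bool) (m : ℕ) :
    Submodule R ((ℕ → Bool × Bool) → K) where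
  carrier := {F | ∀ w, (∃ j, m < j ∧ w j ≠ v j) → F w = 0}
  add_mem' hF hG w hw := by rw [Pi.add_apply, hF w hw, hG w hw, add_zero]
  zero_mem' _ _ := rfl
  smul_mem' r F hF w hw := by rw [Pi.smul_apply, hF w hw, smul_zero]

theorem cupCap_mem_tailSupported {F : (ℕ → Bool × Bool) → K} {m i : ℕ} (hi : i + 1 ≤ m)
    (hF : F ∈ tailSupported R v m) : cupCap R q s i F ∈ tailSupported R v m := by
  rintro w ⟨j, hj, hw⟩
  rw [cupCap_apply]
  split_ifs
  · refine mul_eq_zero_of_right _ (Finset.sum_eq_zero fun x _ => mul_eq_zero_of_right _ ?_)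
    exact hF _ ⟨j, hj, by rwa [writePair_of_ne (by omega) (by omega)]⟩
  · rfl

/-- The generators below `m` change only the places 1 to `m`. -/
theorem tlAlg_apply_mem_tailSupported {m : ℕ} {z : Module.End R ((ℕ → Bool × Bool) → K)}
    (hz : z ∈ tlAlg R (wordSys R q s) m) :
    z (wordIndicator K v) ∈ tailSupported R v m := by
  refine Stable.adjoin (T := tlGen (wordSys R q s) m) ?_ hz fun w ⟨j, _, hw⟩ =>
    wordIndicator_of_ne hw
  rintro _ ⟨i, hi, h2, rfl⟩ F hF
  rw [wordSys_eq]
  exact cupCap_mem_tailSupported (by omega) hF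

/-- A nonzero coefficient survives multiplication by a far generator when the word continues with a
complementary pair. -/
theorem extend_coeff_ne_zero (hq : q ≠ 0) {m : ℕ} {z : Module.End R ((ℕ → Bool × Bool) → K)}
    (hz : z ∈ tlAlg R (wordSys R q s) m) (hv : v (m + 2) = barLetter (v (m + 1)))
    (h0 : z (wordIndicator K v) v ≠ 0) :
    (wordSys R q s (m + 1) * z) (wordIndicator K v) v ≠ 0 := by
  rw [Module.End.mul_apply]
  refine cupCap_apply_ne_zero (i := m + 1) (s := 1) hq (by simp) hv (v (m + 1)) ?_ ?_
  · intro x hx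
    exact tlAlg_apply_mem_tailSupported hz _ ⟨m + 1, by omega, by rwa [writePair_left]⟩
  · rwa [writePair_self hv]

/-- The words that begin with `k` equal letters see the Jones–Wenzl projections as identities. -/
theorem jonesWenzl_coeff {δ μ : R} {k : ℕ} (hk : 2 ≤ k)
    (hv : ∀ j, 1 ≤ j → j ≤ k → v j = (true, true)) (y : Module.End R ((ℕ → Bool × Bool) → K)) :
    (jonesWenzl δ μ (wordSys R q s) k * y * jonesWenzl δ μ (wordSys R q s) k)
      (wordIndicator K v) v = y (wordIndicator K v) v := by
  have h1 : jonesWenzl δ μ (wordSys R q s) k (wordIndicator K v) = wordIndicator K v := by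
    refine jonesWenzl_apply_of_killed δ μ fun i hi => ?_
    rw [wordSys_eq]
    exact cupCap_wordIndicator (by rw [hv _ (by omega) (by omega), hv _ (by omega) (by omega)])
  have h2 : ∀ F, jonesWenzl δ μ (wordSys R q s) k F v = F v := by
    intro F
    have := jonesWenzl_apply_sub_mem (e := wordSys R q s) (m := k) δ μ
      (S := LinearMap.ker (LinearMap.proj v : ((ℕ → Bool × Bool) → K) →ₗ[R] K)) (fun i hi G => by
        rw [wordSys_eq, LinearMap.mem_ker, LinearMap.proj_apply]
        refine cupCap_apply_of_ne _ ?_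
        rw [hv _ (by omega) (by omega), hv _ (by omega) (by omega)]
        exact (barLetter_ne _).symm) F
    rwa [LinearMap.mem_ker, LinearMap.proj_apply, Pi.sub_apply, sub_eq_zero] at this
  rw [Module.End.mul_apply, Module.End.mul_apply, h1, h2]

theorem cupCap_coeff_one (hq : q ≠ 0) {k : ℕ} (hv : v (k + 1) = barLetter (v k)) :
    cupCap R q 1 k (wordIndicator K v) v ≠ 0 := by
  refine cupCap_apply_ne_zero hq (by simp) hv (v k) ?_ ?_
  · intro x hx
    exact wordIndicator_of_ne (j := k) (by rwa [writePair_left])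
  · rw [writePair_self hv, wordIndicator_self]
    exact one_ne_zero

/-- Write ± for the two letters of a block. The only path from ++−− back to itself passes through
+−+−, so the coefficient is a product of nonzero weights. -/
theorem cupCap_coeff_two (hq : q ≠ 0) {k : ℕ} (h1 : v k = (true, true))
    (h2 : v (k + 1) = (true, true)) (h3 : v (k + 2) = (true, false))
    (h4 : v (k + 3) = (true, false)) :
    (cupCap R q 1 (k + 1) * cupCap R q 1 k * cupCap R q 1 (k + 2) * cupCap R q 1 (k + 1))
      (wordIndicator K v) v ≠ 0 := by
  simp only [Module.End.mul_apply]
  set H := cupCap R q 1 (k + 1) (wordIndicator K v) with hH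
  have hHsupp : ∀ w j, j ≠ k + 1 → j ≠ k + 2 → w j ≠ v j → H w = 0 := by
    intro w j hj1 hj2 hw
    rw [hH, cupCap_apply]
    split_ifs
    · refine mul_eq_zero_of_right _ (Finset.sum_eq_zero fun x _ => mul_eq_zero_of_right _ ?_)
      exact wordIndicator_of_ne (j := j) (by rwa [writePair_of_ne hj1 hj2])
    · rfl
  have hs : ∀ x, (1 : Bool × Bool → K) x ≠ 0 := by simp
  set w := writePair v (k + 1) (true, false) with hw
  have w1 : w k = (true, true) := by rw [hw, writePair_of_ne (by omega) (by omega), h1]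
  have w2 : w (k + 1) = (true, false) := writePair_left
  have w3 : w (k + 2) = (true, true) := writePair_right
  have w4 : w (k + 3) = (true, false) := by rw [hw, writePair_of_ne (by omega) (by omega), h4]
  refine cupCap_apply_ne_zero hq hs (by rw [h2]; exact h3) (true, false) ?_ ?_
  · intro x hx
    apply cupCap_apply_of_ne
    rw [writePair_left, writePair_of_ne (by omega) (by omega), h1]
    exact hx
  rw [← hw]
  refine cupCap_apply_ne_zero hq hs (by rw [w1, w2]; rfl) (true, true) ?_ ?_
  · intro x hx
    rw [cupCap_apply]
    split_ifs
    · refine mul_eq_zero_of_right _ (Finset.sum_eq_zero fun y _ => mul_eq_zero_of_right _ ?_)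
      refine hHsupp _ k (by omega) (by omega) ?_
      rw [writePair_of_ne (by omega) (by omega), writePair_left, h1]
      exact hx
    · rfl
  have hw0 : writePair w k (true, true) = w := by
    have := writePair_self (w := w) (i := k) (by rw [w1, w2]; rfl)
    rwa [w1] at this
  rw [hw0]
  refine cupCap_apply_ne_zero hq hs (by rw [w3]; exact w4) (true, true) ?_ ?_
  · intro x hx
    refine hHsupp _ (k + 3) (by omega) (by omega) ?_
    rw [writePair_right, h4, Ne, ← show barLetter (true, true) = (true, false) from rfl]
    intro hb
    exact hx (by rw [← barLetter_bar x, hb, barLetter_bar])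
  have hw0 : writePair w (k + 2) (true, true) = w := by
    have := writePair_self (w := w) (i := k + 2) (by rw [w3]; exact w4)
    rwa [w3] at this
  rw [hw0, hH]
  refine cupCap_apply_ne_zero hq hs (by rw [w2]; exact w3) (true, true) ?_ ?_
  · intro x hx
    exact wordIndicator_of_ne (j := k + 1) (by rwa [writePair_left, h2])
  · have : writePair w (k + 1) (true, true) = v := by
      rw [hw, writePair_writePair, ← h2]
      exact writePair_self (by rw [h2]; exact h3)
    rw [this, wordIndicator_self]
    exact one_ne_zero

end TestWords

/-! ### Complete reducibility forces nonzero scalars -/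

section Necessity

variable {R K : Type*} [Field R] [Field K] [Algebra R K] {q : K} {s : Bool × Bool → K}
  {δ κ μ : R} {n : ℕ}

theorem wordSys_sandwich_of_add_two {v : ℕ → Bool × Bool} (hq : q ≠ 0)
    (h : TLSys δ n (wordSys R q s)) (hf : ForkRel κ (wordSys R q s)) {m : ℕ} (hm : 2 ≤ m)
    (hv : ∀ i, v (m + 2 * i + 2) = barLetter (v (m + 2 * i + 1)))
    (hz : ∃ z ∈ tlAlg R (wordSys R q s) m, (∀ a ∈ tlAlg R (wordSys R q s) m, z * a * z = 0) ∧
      z (wordIndicator K v) v ≠ 0) (i : ℕ) (hi : m + 2 * i ≤ n) :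
    ∃ z ∈ tlAlg R (wordSys R q s) (m + 2 * i),
      (∀ a ∈ tlAlg R (wordSys R q s) (m + 2 * i), z * a * z = 0) ∧
        z (wordIndicator K v) v ≠ 0 := by
  induction i with
  | zero => exact hz
  | succ i ih =>
    obtain ⟨z, hz, hzz, h0⟩ := ih (by omega)
    exact ⟨wordSys R q s (m + 2 * i + 1) * z,
      mul_mem (tlAlg_mem R (m := m + 2 * (i + 1)) (by omega) (by omega))
        (tlAlg_mono R (by omega) hz),
      h.sandwich_extend hf (m := m + 2 * i) (by omega) hi hz hzz, extend_coeff_ne_zero hq hz (hv i) h0⟩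

/-- At the first vanishing scalar the projection still exists and yields a `z` with z a z = 0. The
parity of `n - k` decides between the two starting elements, and a test word shows `z ≠ 0`. -/
theorem tau_ne_zero_of_stablyComplemented (hq : q ≠ 0) (h : TLSys δ n (wordSys R q s))
    (hf : ForkRel κ (wordSys R q s)) (hμ : μ * (δ + κ) = 1)
    (hc : StablyComplemented (tlGen (wordSys R q s) n)) {k : ℕ} (hk : 2 ≤ k) (hkn : k < n) :
    tau δ μ k ≠ 0 := by
  induction k using Nat.strong_induction_on with
  | _ k ih =>
    intro ht
    obtain ⟨hj, hth⟩ := isJonesWenzl_and_through h hf hμ hk hkn.le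
      fun l hl hlk => ih l hlk hl (by omega)
    have hth := hth hkn
    rw [ht, zero_smul] at hth
    have hmem := jonesWenzl_mem δ μ (wordSys R q s) k
    set f := jonesWenzl δ μ (wordSys R q s) k with hfdef
    obtain ⟨k', rfl⟩ := Nat.exists_eq_add_of_le' (show 1 ≤ k by omega)
    have hgen : ∀ {i m : ℕ}, 2 ≤ m → i < m → wordSys R q s i ∈ tlAlg R (wordSys R q s) m :=
      fun h2 hi => tlAlg_mem R h2 hi
    have hmono : ∀ {m : ℕ}, k' + 1 ≤ m → f ∈ tlAlg R (wordSys R q s) m :=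
      fun hm => tlAlg_mono R hm hmem
    suffices hz : ∃ v : ℕ → Bool × Bool, ∃ z ∈ tlAlg R (wordSys R q s) n,
        (∀ a ∈ tlAlg R (wordSys R q s) n, z * a * z = 0) ∧ z (wordIndicator K v) v ≠ 0 by
      obtain ⟨v, z, hz, hzz, h0⟩ := hz
      rw [hc.eq_zero_of_sandwich hz hzz] at h0
      exact h0 rfl
    rcases Nat.even_or_odd' (n - (k' + 1)) with ⟨i, hi | hi⟩
    · obtain ⟨i, rfl⟩ := Nat.exists_eq_add_of_le' (show 1 ≤ i by omega)
      have hn : n = k' + 1 + 2 + 2 * i := by omega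
      -- With k = k' + 1: k letters +, then −−, then pairs +−. The projection fixes the initial
      -- block, ++−− is read around place k, and each later pair feeds one extension.
      set v : ℕ → Bool × Bool := fun j =>
        (true, decide (j ≤ k' + 1 ∨ (k' + 4 ≤ j ∧ (j - k') % 2 = 0))) with hv
      refine ⟨v, hn ▸ wordSys_sandwich_of_add_two hq h hf (by omega) ?_ ?_ i (by omega)⟩
      · intro l
        simp only [hv, barLetter, Prod.mk.injEq, true_and, ← decide_not, decide_eq_decide]
        omega
      · refine ⟨f * (wordSys R q s (k' + 1) * wordSys R q s (k' + 1 - 1) *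
          wordSys R q s (k' + 1 + 1) * wordSys R q s (k' + 1)) * f, ?_,
          hj.sandwich_two h hk (by omega) hmem hth, ?_⟩
        · exact mul_mem (mul_mem (hmono (by omega)) (mul_mem (mul_mem (mul_mem
            (hgen (by omega) (by omega)) (hgen (by omega) (by omega)))
            (hgen (by omega) (by omega))) (hgen (by omega) (by omega)))) (hmono (by omega))
        · rw [hfdef, jonesWenzl_coeff hk]
          · obtain ⟨k, rfl⟩ := Nat.exists_eq_add_of_le' (show 1 ≤ k' by omega)
            exact cupCap_coeff_two (k := k + 1) hq (by simp [hv]) (by simp [hv]) (by simp [hv])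
              (by simp [hv])
          · intro j h1 h2
            simp [hv, h2]
    · have hn : n = k' + 1 + 1 + 2 * i := by omega
      -- Here k letters + are followed by a single −, then by pairs +−.
      set v : ℕ → Bool × Bool := fun j =>
        (true, decide (j ≤ k' + 1 ∨ (j - k') % 2 = 1)) with hv
      refine ⟨v, hn ▸ wordSys_sandwich_of_add_two hq h hf (by omega) ?_ ?_ i (by omega)⟩
      · intro l
        simp only [hv, barLetter, Prod.mk.injEq, true_and, ← decide_not, decide_eq_decide]
        omega
      · refine ⟨f * wordSys R q s (k' + 1) * f, ?_, hj.sandwich_one hth, ?_⟩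
        · exact mul_mem (mul_mem (hmono (by omega)) (hgen (by omega) (by omega)))
            (hmono (by omega))
        · rw [hfdef, jonesWenzl_coeff hk]
          · exact cupCap_coeff_one hq (by simp [hv, barLetter]; omega)
          · intro j h1 h2
            simp [hv, h2]

end Necessity

/-! ### The deformed reflection representation and δ ≠ 0 -/

section Reflection

variable {R : Type*} [Field R] {δ : R}

instance : DecidableRel AdjD := fun i j => by unfold AdjD; infer_instance

/-- The rows of the matrix `δ + adjacency matrix` of the infinite diagram of type `D`. -/
def dynkinRow (δ : R) (i : ℕ) : (ℕ → R) →ₗ[R] R :=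
  -- Neighbours of `i` are at most `i + 2`, attained by the edge from 0 to 2.
  δ • LinearMap.proj i + ∑ j ∈ Finset.range (i + 3), if AdjD i j then LinearMap.proj j else 0

theorem dynkinRow_single (δ : R) (i k : ℕ) : dynkinRow δ i (Pi.single k 1) =
    if i = k then δ else if AdjD i k then 1 else 0 := by
  have h : ∀ j, (if AdjD i j then LinearMap.proj j else (0 : (ℕ → R) →ₗ[R] R)) (Pi.single k 1) =
      if j = k then (if AdjD i k then 1 else 0) else 0 := by
    intro j
    by_cases hj : j = k
    · subst hj
      by_cases ha : AdjD i j <;> simp [ha]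
    · split_ifs <;> simp [hj]
  simp only [dynkinRow, LinearMap.add_apply, LinearMap.smul_apply, LinearMap.sum_apply, h,
    LinearMap.proj_apply, Finset.sum_ite_eq', Finset.mem_range]
  by_cases hik : i = k
  · subst hik
    have : ¬ AdjD i i := by unfold AdjD; omega
    simp [this]
  · have : AdjD i k → k < i + 3 := by unfold AdjD; omega
    by_cases ha : AdjD i k
    · simp [hik, ha, this ha]
    · simp [hik, ha]

/-- The module of the diagram of type `D` that deforms the reflection representation. -/
def reflSys (δ : R) (i : ℕ) : Module.End R (ℕ → R) :=
  (dynkinRow δ i).smulRight (Pi.single i 1)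

theorem reflSys_apply (i : ℕ) (v : ℕ → R) :
    reflSys δ i v = dynkinRow δ i v • Pi.single i 1 := rfl

theorem reflSys_tlSys (δ : R) (n : ℕ) : TLSys δ n (reflSys δ) := by
  have hirr : ∀ i, ¬ AdjD i i := fun i => by unfold AdjD; omega
  have hsymm : ∀ i j, AdjD i j → AdjD j i := fun i j => by unfold AdjD; omega
  have hne : ∀ i j, AdjD i j → i ≠ j := fun i j h => by rintro rfl; exact hirr _ h
  refine ⟨fun i _ => ?_, fun i j _ _ hij => ?_, fun i j _ _ hij => ?_⟩ <;>
    refine LinearMap.ext fun v => ?_ <;>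
    simp only [Module.End.mul_apply, LinearMap.smul_apply, reflSys_apply, map_smul,
      dynkinRow_single, smul_smul]
  · simp [mul_comm]
  · by_cases h : i = j
    · rw [h]
    · have h' : ¬ AdjD j i := fun hji => hij (hsymm j i hji)
      simp [h, Ne.symm h, hij, h']
  · simp [hne i j hij, (hne i j hij).symm, hij, hsymm i j hij]

/-- The vertices 0 and 1 have the same neighbours, so at δ = 0 the difference of their basis vectors
is killed by every generator. A stable complement of its line would contain both basis vectors, as
images of a component of the basis vector at 2, and hence the difference. -/
theorem ne_zero_of_stablyComplemented_reflSys {n : ℕ} (hn : 3 ≤ n)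
    (h : StablyComplemented (tlGen (reflSys δ) n)) : δ ≠ 0 := by
  rintro rfl
  set v : ℕ → R := Pi.single 0 1 - Pi.single 1 1 with hv
  have hkill : ∀ i, reflSys (0 : R) i v = 0 := by
    intro i
    have h01 : AdjD i 0 ↔ AdjD i 1 := by unfold AdjD; omega
    rw [reflSys_apply, hv, map_sub, dynkinRow_single, dynkinRow_single]
    by_cases ha : AdjD i 1
    · have h0 : i ≠ 0 ∧ i ≠ 1 := by unfold AdjD at ha; omega
      simp [h01, ha, h0.1, h0.2]
    · simp [h01, ha]
  have hst : Stable (tlGen (reflSys (0 : R)) n) (Submodule.span R {v}) := by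
    rintro _ ⟨i, -, -, rfl⟩ x hx
    obtain ⟨r, rfl⟩ := Submodule.mem_span_singleton.1 hx
    rw [map_smul, hkill, smul_zero]
    exact zero_mem _
  obtain ⟨C, hC, hi⟩ := h _ hst
  have hx : Pi.single 2 1 ∈ Submodule.span R {v} ⊔ C := hi.sup_eq_top ▸ Submodule.mem_top
  obtain ⟨y, hy, c, hc, hyc⟩ := Submodule.mem_sup.1 hx
  obtain ⟨r, rfl⟩ := Submodule.mem_span_singleton.1 hy
  have key : ∀ i < 2, Pi.single i 1 ∈ C := by
    intro i hi2
    have h1 : reflSys (0 : R) i c = Pi.single i 1 := by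
      have h2 : AdjD i 2 := by unfold AdjD; omega
      have := congrArg (reflSys (0 : R) i) hyc
      rw [map_add, map_smul, hkill, smul_zero, zero_add] at this
      rw [this, reflSys_apply, dynkinRow_single, if_neg (by omega), if_pos h2, one_smul]
    rw [← h1]
    exact hC _ ⟨i, by omega, by omega, rfl⟩ c hc
  have hvC : v ∈ C := C.sub_mem (key 0 (by omega)) (key 1 (by omega))
  have hv0 := Submodule.disjoint_def.1 hi.disjoint v (Submodule.mem_span_singleton_self v) hvC
  have := congrFun hv0 0
  simp [hv] at this

end Reflection

/-! ### The presented algebra and its modules -/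

section Presentation

variable {R : Type*} [Field R] {δ : R} {n : ℕ}

/-- The generators of `TLD n δ`, extended by zero. -/
noncomputable def tldGen (n : ℕ) (δ : R) (i : ℕ) : TLD n δ :=
  if h : i < n then RingQuot.mkAlgHom R (TLD.Rel n δ) (FreeAlgebra.ι R ⟨i, h⟩) else 0

theorem dynkinD_adj_iff (i j : Fin n) : (dynkinD n).Adj i j ↔ AdjD i j := by
  rw [dynkinD, SimpleGraph.fromRel_adj, Ne, Fin.ext_iff]
  unfold AdjD
  omega

theorem tldGen_tlSys (n : ℕ) (δ : R) : TLSys δ n (tldGen n δ) := by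
  refine ⟨fun i hi => ?_, fun i j hi hj hij => ?_, fun i j hi hj hij => ?_⟩
  · simpa [tldGen, hi] using RingQuot.mkAlgHom_rel R (TLD.Rel.sq (δ := δ) (⟨i, hi⟩ : Fin n))
  · simpa [tldGen, hi, hj] using RingQuot.mkAlgHom_rel R
      (TLD.Rel.comm (δ := δ) (⟨i, hi⟩ : Fin n) ⟨j, hj⟩ (by rwa [dynkinD_adj_iff]))
  · simpa [tldGen, hi, hj] using RingQuot.mkAlgHom_rel R
      (TLD.Rel.adj (δ := δ) (⟨i, hi⟩ : Fin n) ⟨j, hj⟩ (by rwa [dynkinD_adj_iff]))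

theorem adjoin_tldGen (hn : 2 ≤ n) (t : TLD n δ) :
    t ∈ Algebra.adjoin R (tlGen (tldGen n δ) n) := by
  obtain ⟨a, rfl⟩ := RingQuot.mkAlgHom_surjective R (TLD.Rel n δ) t
  induction a using FreeAlgebra.induction with
  | grade0 r => rw [AlgHom.commutes]; exact Subalgebra.algebraMap_mem _ _
  | grade1 i => exact Algebra.subset_adjoin ⟨i, i.2, hn, by simp [tldGen]⟩
  | mul a b ha hb => rw [map_mul]; exact mul_mem ha hb
  | add a b ha hb => rw [map_add]; exact add_mem ha hb

/-- A system of elements satisfying the relations receives a homomorphism from `TLD n δ`. -/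
noncomputable def TLSys.lift {A : Type*} [Ring A] [Algebra R A] {e : ℕ → A} (h : TLSys δ n e) :
    TLD n δ →ₐ[R] A :=
  RingQuot.liftAlgHom R ⟨FreeAlgebra.lift R fun i : Fin n => e i, fun {x y} hxy => by
    cases hxy with
    | sq i => simpa using h.sq i i.2
    | comm i j hij => simpa using h.comm i j i.2 j.2 (by rwa [← dynkinD_adj_iff])
    | adj i j hij => simpa using h.adj i j i.2 j.2 (by rwa [← dynkinD_adj_iff])⟩

theorem TLSys.lift_tldGen {A : Type*} [Ring A] [Algebra R A] {e : ℕ → A} (h : TLSys δ n e) {i : ℕ}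
    (hi : i < n) : h.lift (tldGen n δ i) = e i := by
  simp [TLSys.lift, tldGen, hi]

theorem stablyComplemented_of_isSemisimpleRing (hn : 2 ≤ n) (hs : IsSemisimpleRing (TLD n δ))
    {M : Type*} [AddCommGroup M] [Module R M] {e : ℕ → Module.End R M} (h : TLSys δ n e) :
    StablyComplemented (tlGen e n) := by
  let _ : Module (TLD n δ) M := Module.compHom M h.lift.toRingHom
  have hsmul : ∀ (t : TLD n δ) (x : M), t • x = h.lift t x := fun _ _ => rfl
  intro N hN
  have hlift : ∀ t, h.lift t ∈ Algebra.adjoin R (tlGen e n) := by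
    intro t
    have ht := adjoin_tldGen hn t
    induction ht using Algebra.adjoin_induction with
    | mem t ht =>
      obtain ⟨i, hi, -, rfl⟩ := ht
      rw [h.lift_tldGen hi]
      exact Algebra.subset_adjoin ⟨i, hi, hn, rfl⟩
    | algebraMap r => rw [AlgHom.commutes]; exact Subalgebra.algebraMap_mem _ _
    | add a b _ _ ha hb => rw [map_add]; exact add_mem ha hb
    | mul a b _ _ ha hb => rw [map_mul]; exact mul_mem ha hb
  let N' : Submodule (TLD n δ) M :=
    { N.toAddSubmonoid with smul_mem' := fun t x hx => hN.adjoin (hlift t) hx }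
  obtain ⟨C', hC'⟩ := exists_isCompl N'
  let C : Submodule R M :=
    { C'.toAddSubmonoid with
      smul_mem' := fun r x hx => by
        have := C'.smul_mem (algebraMap R (TLD n δ) r) hx
        rwa [hsmul, AlgHom.commutes] at this }
  refine ⟨C, ?_, ?_⟩
  · rintro _ ⟨i, hi, -, rfl⟩ x hx
    have := C'.smul_mem (tldGen n δ i) hx
    rwa [hsmul, h.lift_tldGen hi] at this
  · constructor
    · rw [Submodule.disjoint_def]
      exact fun x hx hx' => Submodule.disjoint_def.1 hC'.disjoint x hx hx'
    · rw [codisjoint_iff, eq_top_iff]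
      intro x _
      have hx : x ∈ N' ⊔ C' := hC'.sup_eq_top ▸ Submodule.mem_top
      obtain ⟨y, hy, c, hc, rfl⟩ := Submodule.mem_sup.1 hx
      exact Submodule.add_mem_sup (show y ∈ N from hy) (show c ∈ C from hc)

theorem tldGen_mulLeft_tlSys (n : ℕ) (δ : R) :
    TLSys δ n fun i => Algebra.lmul R (TLD n δ) (tldGen n δ i) := by
  have h := tldGen_tlSys n δ
  refine ⟨fun i hi => ?_, fun i j hi hj hij => ?_, fun i j hi hj hij => ?_⟩
  · rw [← map_mul, h.sq i hi, map_smul]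
  · rw [← map_mul, ← map_mul, h.comm i j hi hj hij]
  · rw [← map_mul, ← map_mul, h.adj i j hi hj hij]

theorem isSemisimpleRing_of_stablyComplemented (hn : 2 ≤ n)
    (h : StablyComplemented (tlGen (fun i => Algebra.lmul R (TLD n δ) (tldGen n δ i)) n)) :
    IsSemisimpleRing (TLD n δ) := by
  refine (isSemisimpleModule_iff _ _).2 ⟨fun N => ?_⟩
  obtain ⟨C, hC, hi⟩ := h (N.restrictScalars R) (by
    rintro _ ⟨i, hi, -, rfl⟩ x hx
    exact N.smul_mem _ hx)
  let C' : Submodule (TLD n δ) (TLD n δ) :=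
    { C.toAddSubmonoid with
      smul_mem' := fun t x hx => by
        have ht := adjoin_tldGen hn t
        change t * x ∈ C
        replace hx : x ∈ C := hx
        induction ht using Algebra.adjoin_induction generalizing x with
        | mem t ht =>
          obtain ⟨i, hi, -, rfl⟩ := ht
          exact hC _ ⟨i, hi, hn, rfl⟩ x hx
        | algebraMap r => rw [← Algebra.smul_def]; exact C.smul_mem r hx
        | add a b _ _ ha hb => rw [add_mul]; exact C.add_mem (ha x hx) (hb x hx)
        | mul a b _ _ ha hb => rw [mul_assoc]; exact ha _ (hb x hx) }
  refine ⟨C', ?_, ?_⟩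
  · rw [Submodule.disjoint_def]
    exact fun x hx hx' => Submodule.disjoint_def.1 hi.disjoint x hx hx'
  · rw [codisjoint_iff, eq_top_iff]
    intro x _
    have hx : x ∈ N.restrictScalars R ⊔ C := hi.sup_eq_top ▸ Submodule.mem_top
    obtain ⟨y, hy, c, hc, rfl⟩ := Submodule.mem_sup.1 hx
    exact Submodule.add_mem_sup (show y ∈ N from hy) (show c ∈ C' from hc)

end Presentation

/-! ### Chebyshev values and parameters -/

section Chebyshev

variable {R : Type*} [Field R] {δ : R} {n : ℕ}

theorem aeval_chebyshevA_succ (δ : R) (m : ℕ) : Polynomial.aeval δ (chebyshevA (m + 2)) =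
    δ * Polynomial.aeval δ (chebyshevA (m + 1)) - Polynomial.aeval δ (chebyshevA m) := by
  simp [chebyshevA]

theorem aeval_chebyshevD_succ (δ : R) {m : ℕ} (hm : 2 ≤ m) :
    Polynomial.aeval δ (chebyshevD (m + 2)) =
      δ * Polynomial.aeval δ (chebyshevD (m + 1)) - Polynomial.aeval δ (chebyshevD m) := by
  obtain ⟨k, rfl⟩ := Nat.exists_eq_add_of_le' hm
  simp [chebyshevD]

/-- The scalars `tau` are the quotients of consecutive values of a sequence satisfying the Chebyshev
recursion. -/
theorem eq_tau_mul {δ μ : R} {p : ℕ → R} {n : ℕ} (h3 : p 3 = (δ - 2 * μ) * p 2)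
    (hp : ∀ m, 2 ≤ m → p (m + 2) = δ * p (m + 1) - p m)
    (hτ : ∀ k, 2 ≤ k → k + 1 < n → tau δ μ k ≠ 0) {k : ℕ} (hk : 2 ≤ k) (hkn : k < n) :
    p (k + 1) = tau δ μ k * p k := by
  induction k, hk using Nat.le_induction with
  | base => exact h3
  | succ k hk ih =>
    have h0 := hτ k hk hkn
    rw [hp k hk, tau_succ _ _ hk, ih (by omega)]
    field_simp

/-- The relation p_{k+1} = τ_k p_k is available only up to the first zero of τ, after which the
inverse in the recursion takes its default value 0. That is enough to match the first zeros on both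
sides. -/
theorem tau_ne_zero_iff {δ μ : R} {p : ℕ → R} {n : ℕ} (h2 : p 2 ≠ 0)
    (h3 : p 3 = (δ - 2 * μ) * p 2) (hp : ∀ m, 2 ≤ m → p (m + 2) = δ * p (m + 1) - p m) :
    (∀ k, 2 ≤ k → k < n → tau δ μ k ≠ 0) ↔ ∀ k, 2 < k → k ≤ n → p k ≠ 0 := by
  constructor
  · intro h k hk hkn
    have key : ∀ k, 2 ≤ k → k ≤ n → p k ≠ 0 := by
      intro k hk
      induction k, hk using Nat.le_induction with
      | base => exact fun _ => h2
      | succ k hk ih =>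
        intro hkn
        rw [eq_tau_mul h3 hp (n := n) (fun l hl hln => h l hl (by omega)) hk hkn]
        exact mul_ne_zero (h k hk hkn) (ih (by omega))
    exact key k hk.le hkn
  · intro h k hk hkn
    induction k using Nat.strong_induction_on with
    | _ k ih =>
      intro h0
      have := eq_tau_mul h3 hp (n := k + 1) (fun l hl hln => ih l (by omega) hl (by omega)) hk
        (by omega)
      rw [h0, zero_mul] at this
      exact h (k + 1) (by omega) hkn this

theorem tau_typeA_ne_zero_iff (h2 : (2 : R) ≠ 0) (hδ : δ ≠ 0) :
    (∀ k, 2 ≤ k → k < n → tau δ (2 * δ)⁻¹ k ≠ 0) ↔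
      ∀ k, 2 < k → k ≤ n → Polynomial.aeval δ (chebyshevA k) ≠ 0 := by
  refine tau_ne_zero_iff (p := fun k => Polynomial.aeval δ (chebyshevA k)) ?_ ?_
    fun m _ => aeval_chebyshevA_succ δ m
  · simpa [chebyshevA] using hδ
  · simp [chebyshevA]
    field_simp

theorem tau_typeD_ne_zero_iff (hδ : δ ≠ 0) :
    (∀ k, 2 ≤ k → k < n → tau δ δ⁻¹ k ≠ 0) ↔
      ∀ k, 2 < k → k ≤ n → Polynomial.aeval δ (chebyshevD k) ≠ 0 := by
  refine tau_ne_zero_iff (p := fun k => Polynomial.aeval δ (chebyshevD k)) ?_ ?_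
    fun m hm => aeval_chebyshevD_succ δ hm
  · simpa [chebyshevD] using hδ
  · have : Polynomial.aeval δ (2 : Polynomial ℤ) = 2 := map_ofNat _ 2
    simp [chebyshevD, this]
    field_simp

theorem exists_quantum_parameter (h2 : (2 : R) ≠ 0) (δ : R) :
    ∃ q : AlgebraicClosure R, q ≠ 0 ∧ 2 * (q + q⁻¹) = algebraMap R (AlgebraicClosure R) δ := by
  have h2' : (2 : AlgebraicClosure R) ≠ 0 := by
    intro h
    apply h2
    apply (algebraMap R (AlgebraicClosure R)).injective
    rw [map_ofNat, map_zero]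
    exact h
  set d := algebraMap R (AlgebraicClosure R) δ
  -- The equation for `q`, cleared of denominators; its constant term 2 makes the root nonzero.
  obtain ⟨q, hq⟩ := IsAlgClosed.exists_root
    (Polynomial.C 2 * Polynomial.X ^ 2 + Polynomial.C (-d) * Polynomial.X + Polynomial.C 2 :
      Polynomial (AlgebraicClosure R)) (by rw [Polynomial.degree_quadratic h2']; decide)
  have hq : 2 * q ^ 2 - d * q + 2 = 0 := by
    simpa [Polynomial.IsRoot, sub_eq_add_neg] using hq
  have hq0 : q ≠ 0 := by
    rintro rfl
    exact h2' (by simpa using hq)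
  refine ⟨q, hq0, ?_⟩
  field_simp
  linear_combination hq

/-- The decoration that tells apart the two blocks of letters. -/
def blockSign {K : Type*} [Field K] (x : Bool × Bool) : K := if x.1 then 1 else -1

theorem blockSign_mul_self {K : Type*} [Field K] (x : Bool × Bool) :
    blockSign x * blockSign x = (1 : K) := by
  unfold blockSign
  split_ifs <;> simp

theorem loopValue_blockSign {K : Type*} [Field K] (q : K) :
    loopValue q blockSign 1 = 0 ∧ loopValue q 1 blockSign = 0 := by
  constructor
  · simp [loopValue, Fintype.sum_prod_type, blockSign, letterWeight, barLetter]
    ring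
  · simp [loopValue, Fintype.sum_prod_type, blockSign, letterWeight, barLetter]

end Chebyshev

/-! ### The semisimplicity criterion -/

theorem theorem6p17 {R : Type*} [Field R] (hR : ringChar R ≠ 2) (δ : R) (n : ℕ) (hn : 4 ≤ n) :
    IsSemisimpleRing (TLD n δ) ↔
      (∀ s : ℕ, 1 < s → s ≤ n → Polynomial.aeval δ (chebyshevA s) ≠ 0) ∧
      (∀ t : ℕ, 2 < t → t ≤ n → Polynomial.aeval δ (chebyshevD t) ≠ 0) := by
  have h2 : (2 : R) ≠ 0 := Ring.two_ne_zero hR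
  constructor
  · intro hs
    have hcomp := fun {M : Type _} [AddCommGroup M] [Module R M] {e : ℕ → Module.End R M}
      (h : TLSys δ n e) => stablyComplemented_of_isSemisimpleRing (by omega) hs h
    have hδ : δ ≠ 0 :=
      ne_zero_of_stablyComplemented_reflSys (by omega) (hcomp (reflSys_tlSys δ n))
    obtain ⟨q, hq, hqδ⟩ := exists_quantum_parameter h2 δ
    have hA : TLSys δ n (wordSys R q 1) :=
      wordSys_tlSys hq (by simp) (Or.inl rfl) hqδ n
    have hD : TLSys δ n (wordSys R q blockSign) :=
      wordSys_tlSys hq blockSign_mul_self (Or.inr (loopValue_blockSign q)) hqδ n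
    have hfA : ForkRel δ (wordSys R q 1) :=
      ⟨hA.sq 0 (by omega), hA.sq 0 (by omega)⟩
    have hfD : ForkRel (0 : R) (wordSys R q blockSign) := by
      have h0 : wordSys R q blockSign 0 * wordSys R q blockSign 1 = 0 :=
        cupCap_mul_eq_zero (loopValue_blockSign q).1
      exact ⟨by rw [h0, zero_smul], by rw [h0, zero_smul]⟩
    refine ⟨fun s hs1 hsn => ?_, (tau_typeD_ne_zero_iff hδ).1 fun k hk hkn =>
      tau_ne_zero_of_stablyComplemented hq hD hfD (by rw [add_zero, inv_mul_cancel₀ hδ])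
        (hcomp hD) hk hkn⟩
    -- P_2(δ) = δ is not a condition on the scalars τ and comes from the reflection representation.
    rcases Nat.eq_or_lt_of_le (show 2 ≤ s by omega) with rfl | hs2
    · simpa [chebyshevA] using hδ
    · exact (tau_typeA_ne_zero_iff h2 hδ).1 (fun k hk hkn =>
        tau_ne_zero_of_stablyComplemented hq hA hfA
          (by rw [← two_mul, inv_mul_cancel₀ (mul_ne_zero h2 hδ)]) (hcomp hA) hk hkn) s hs2 hsn
  · rintro ⟨hP, hQ⟩
    have hδ : δ ≠ 0 := by
      have := hP 2 (by omega) (by omega)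
      simpa [chebyshevA] using this
    exact isSemisimpleRing_of_stablyComplemented (by omega)
      ((tldGen_mulLeft_tlSys n δ).stablyComplemented (by omega) h2 hδ
        ((tau_typeA_ne_zero_iff h2 hδ).2 fun k hk hkn => hP k (by omega) hkn)
        ((tau_typeD_ne_zero_iff hδ).2 hQ))
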